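/- Let $\mathrm{Homeo}^+(\mathbf R)$ be the group of orientation-preserving homeomorphisms of the real line, and let $\mu$ be a finitely supported symmetric probability measure on it ($\mu(g)=\mu(g^{-1})$ for all $g$). Let $G$ be the group generated by the support of $\mu$; assume that $G$ has no global fixed point and acts minimally on $\mathbf R$ (every orbit is dense). Let $g_1,g_2,\dots$ be i.i.d. with law $\mu$ (the coordinates on $(G^{\mathbf N},\mu^{\otimes\mathbf N})$), and put $f_n=g_n\circ\cdots\circ g_1$ and $X_n^x=f_n(x)$. Say that a subgroup $H$ of $\mathrm{Homeo}^+(\mathbf R)$ has the strong contraction property if there is a compact interval $L$ such that for every compact interval $I$ there are $h_n\in H$ with $h_n(I)\subset L$ for all $n$ and $\mathrm{diam}\,h_n(I)\to 0$; and that it has the weak contraction property if this holds for all compact intervals $I$ of length less than $1$. Let $\widetilde{\mathrm{Homeo}}{}^+(\mathbf S^1)$ be the group of all $f\in\mathrm{Homeo}^+(\mathbf R)$ that commute with $x\mapsto x+1$. 1. If $G$ has the strong contraction property, then for all $x<y$ and every compact interval $J$, almost surely $$\mathbf 1_J(X_n^x)\,|X_n^y-X_n^x|\longrightarrow 0\quad\text{as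 } n\to\infty.$$ 2. If $G$ has the weak but not the strong contraction property, then there is $\varphi\in\mathrm{Homeo}^+(\mathbf R)$ such that $\varphi G\varphi^{-1}$ is contained in $\widetilde{\mathrm{Homeo}}{}^+(\mathbf S^1)$ and has the weak contraction property. Moreover, for every $\varphi\in\mathrm{Homeo}^+(\mathbf R)$ such that $\varphi G\varphi^{-1}$ is contained in $\widetilde{\mathrm{Homeo}}{}^+(\mathbf S^1)$ and has the weak contraction property (whether or not $G$ itself has it), and for all $x<y<x+1$, with positive probability one has, for every compact interval $J$, $$\mathbf 1_J(\bar X_n^x)\,|\bar X_n^y-\bar X_n^x|\longrightarrow 0\quad\text{as } n\to\infty,$$ where $\bar X_n^x=(\varphi\circ f_n\circ\varphi^{-1})(x)$ is the chain of the conjugated group. -/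

import Mathlib

open MeasureTheory Filter Topology

/-- Homeomorphisms of the line act on the line by evaluation. -/
instance homeoRealMulAction : MulAction (ℝ ≃ₜ ℝ) ℝ where
  smul f x := f x
  one_smul _ := rfl
  mul_smul _ _ _ := rfl

theorem homeo_smul_def (f : ℝ ≃ₜ ℝ) (x : ℝ) : f • x = f x := rfl

/-- `Homeo⁺(ℝ)`: the group of orientation-preserving (that is, strictly increasing)
homeomorphisms of the real line, under composition. -/
def HomeoPlus : Subgroup (ℝ ≃ₜ ℝ) where
  carrier := {f | StrictMono f}
  one_mem' := fun _ _ h => h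
  mul_mem' := fun hf hg _ _ h => hf (hg h)
  inv_mem' := by
    intro f hf x y h
    have hx : f (f⁻¹ x) = x := f.apply_symm_apply x
    have hy : f (f⁻¹ y) = y := f.apply_symm_apply y
    exact hf.lt_iff_lt.1 (by rw [hx, hy]; exact h)

/-- The group of lifts of orientation-preserving circle homeomorphisms: the elements of
`Homeo⁺(ℝ)` that commute with the translation `x ↦ x + 1`. -/
def CircleLifts : Subgroup HomeoPlus where
  carrier := {f | ∀ x : ℝ, f • (x + 1) = f • x + 1}
  one_mem' := fun _ => rfl
  mul_mem' := by
    intro f g hf hg x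
    rw [mul_smul, mul_smul, hg x, hf (g • x)]
  inv_mem' := by
    intro f hf x
    rw [inv_smul_eq_iff, hf (f⁻¹ • x), smul_inv_smul]

/-- The subgroup `φ G φ⁻¹` of `Homeo⁺(ℝ)`, i.e. `G` after the change of coordinate `φ`. -/
def conjugateGroup (φ : HomeoPlus) (G : Subgroup HomeoPlus) : Subgroup HomeoPlus :=
  G.map (MulAut.conj φ).toMonoidHom

/-- No global fixed point. -/
def IsIrreducibleAction (G : Subgroup HomeoPlus) : Prop :=
  ∀ x : ℝ, ∃ g : G, g • x ≠ x

/-- There is a sequence `h n` in `G` such that `h n (I) ⊆ L` for all `n` and the diameter of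
`h n (I)` tends to zero. -/
def ContractsInto (G : Subgroup HomeoPlus) (I L : Set ℝ) : Prop :=
  ∃ h : ℕ → G, (∀ n, (fun t : ℝ => h n • t) '' I ⊆ L) ∧
    Tendsto (fun n => Metric.diam ((fun t : ℝ => h n • t) '' I)) atTop (𝓝 0)

/-- The strong contraction property: some compact interval `L` is such that every compact
interval can be contracted into `L`. -/
def StrongContraction (G : Subgroup HomeoPlus) : Prop :=
  ∃ l₁ l₂ : ℝ, l₁ ≤ l₂ ∧
    ∀ c d : ℝ, c ≤ d → ContractsInto G (Set.Icc c d) (Set.Icc l₁ l₂)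

/-- The weak contraction property: the same for compact intervals of length less than `1`. -/
def WeakContraction (G : Subgroup HomeoPlus) : Prop :=
  ∃ l₁ l₂ : ℝ, l₁ ≤ l₂ ∧
    ∀ c d : ℝ, c ≤ d → d - c < 1 → ContractsInto G (Set.Icc c d) (Set.Icc l₁ l₂)

/-- Groups of homeomorphisms carry the discrete σ-algebra. -/
instance homeoSubgroupMeasurableSpace (G : Subgroup HomeoPlus) : MeasurableSpace G := ⊤

/-- The law `μ^{⊗ℕ}` on `G^ℕ`; the `n`-th coordinate of `ω` is the increment `g_{n+1}`. -/
noncomputable def incrementLaw {G : Subgroup HomeoPlus} (μ : PMF G) : Measure (ℕ → G) :=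
  Measure.infinitePi (fun _ : ℕ => μ.toMeasure)

/-- The left random walk `f_n = g_n ∘ ⋯ ∘ g_1`. -/
def leftWalk {G : Subgroup HomeoPlus} (ω : ℕ → G) : ℕ → G
  | 0 => 1
  | n + 1 => ω n * leftWalk ω n

/-- The Markov chain `X_n^x = f_n(x)`. -/
def chain {G : Subgroup HomeoPlus} (ω : ℕ → G) (x : ℝ) (n : ℕ) : ℝ :=
  leftWalk ω n • x

/-- The Markov chain of the conjugated group, `X_n^x = (φ ∘ f_n ∘ φ⁻¹)(x)`, whose increments are
`φ g_i φ⁻¹`. -/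
def conjugateChain {G : Subgroup HomeoPlus} (φ : HomeoPlus) (ω : ℕ → G) (x : ℝ) (n : ℕ) : ℝ :=
  (φ * (leftWalk ω n : HomeoPlus) * φ⁻¹) • x

/-- `1_J(u_n) |v_n - u_n| → 0` as `n → ∞`. -/
def StableAlong (J : Set ℝ) (u v : ℕ → ℝ) : Prop :=
  Tendsto (fun n => J.indicator (fun _ => (1 : ℝ)) (u n) * |v n - u n|) atTop (𝓝 0)

/-! The idea is to find an increasing continuous coordinate `F` with `P F = F + c`, where `P` is the
averaging operator `avg`. Then `D(x, y) = |F y - F x|` is a nonnegative martingale for the two-point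
motion (`avg_pairDist`). Fix a barrier `M`. While `D` is at most `M`, at least `ε`, and the left
point lies in a compact interval, the pair lies in a compact set, from which contraction makes `D`
small within bounded time and with probability bounded below. Each such visit costs the
supermartingale `√D` a definite expected amount, so there are finitely many visits
(`ae_eventually_notMem`). Stability thus fails only if `D` reaches `M`, which has probability at
most `D / M` (`incrementLaw_not_stable_le`).

Under strong contraction `c = 0` and `F` is unbounded above, so `M` can tend to infinity. For lifts
of circle maps `F` gains exactly one under the unit translation, so a pair less than one period
apart has `D < 1`, and any `M` strictly between `D` and `1` gives a failure probability below one.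

The coordinate is a limit of normalized potentials. Symmetry under inversion identifies increments
of `∑ P^k 1_{(t, ∞)}` with expected visits of the walk from `t` to an interval. These diverge:
otherwise the potential `H` would exist and `|H|` would be a nonnegative function losing `1/2` per
step away from a bounded set (`exists_not_summable`). The same recurrence forces the limit to be
continuous and unbounded above, while minimality makes it strictly increasing.

When contraction is weak but not strong, the map sending `x` to the supremum of the right ends of
contractible intervals starting at `x` is a homeomorphism commuting with `G`; conjugating it to the
unit translation puts `G` into the circle lifts. -/

/-- A finitely supported symmetric probability law on a group whose support generates it. -/
structure SymmetricLaw (Γ : Type*) [Group Γ] where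
  supp : Finset Γ
  weight : Γ → ℝ
  weight_pos : ∀ g ∈ supp, 0 < weight g
  sum_weight : ∑ g ∈ supp, weight g = 1
  inv_mem : ∀ g ∈ supp, g⁻¹ ∈ supp
  weight_inv : ∀ g, weight g⁻¹ = weight g
  closure_supp : Subgroup.closure (supp : Set Γ) = ⊤

namespace SymmetricLaw

/-! ### The Markov operator on an arbitrary `Γ`-space. -/

section Averaging

variable {Γ : Type*} [Group Γ] (m : SymmetricLaw Γ) {Z : Type*} [MulAction Γ Z]

/-- The Markov operator `f ↦ (z ↦ 𝔼 f (g • z))` of the random walk. -/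
def avg : Module.End ℝ (Z → ℝ) where
  toFun f z := ∑ g ∈ m.supp, m.weight g * f (g • z)
  map_add' f f' := by
    funext z
    simp [mul_add, Finset.sum_add_distrib]
  map_smul' c f := by
    funext z
    simp only [Pi.smul_apply, smul_eq_mul, RingHom.id_apply, Finset.mul_sum]
    exact Finset.sum_congr rfl fun g _ => by ring

theorem avg_apply (f : Z → ℝ) (z : Z) :
    m.avg f z = ∑ g ∈ m.supp, m.weight g * f (g • z) := rfl

theorem avg_const (c : ℝ) : m.avg (fun _ : Z => c) = fun _ => c := by
  funext z
  rw [avg_apply, ← Finset.sum_mul, m.sum_weight, one_mul]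

theorem avg_mono {f f' : Z → ℝ} (h : f ≤ f') : m.avg f ≤ m.avg f' := fun _ =>
  Finset.sum_le_sum fun g hg => mul_le_mul_of_nonneg_left (h _) (m.weight_pos g hg).le

theorem avg_pow_succ (k : ℕ) (f : Z → ℝ) : (m.avg ^ (k + 1)) f = m.avg ((m.avg ^ k) f) := by
  rw [pow_succ']; rfl

theorem avg_pow_succ' (k : ℕ) (f : Z → ℝ) : (m.avg ^ (k + 1)) f = (m.avg ^ k) (m.avg f) := by
  rw [pow_succ]; rfl

theorem avg_pow_add (j k : ℕ) (f : Z → ℝ) :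
    (m.avg ^ (j + k)) f = (m.avg ^ j) ((m.avg ^ k) f) := by
  rw [pow_add]; rfl

theorem avg_pow_const (k : ℕ) (c : ℝ) : (m.avg ^ k) (fun _ : Z => c) = fun _ => c := by
  induction k with
  | zero => rfl
  | succ k ih => rw [avg_pow_succ, ih, avg_const]

theorem avg_pow_mono (k : ℕ) {f f' : Z → ℝ} (h : f ≤ f') :
    (m.avg ^ k) f ≤ (m.avg ^ k) f' := by
  induction k with
  | zero => exact h
  | succ k ih => rw [avg_pow_succ, avg_pow_succ]; exact m.avg_mono ih

theorem avg_pow_nonneg (k : ℕ) {f : Z → ℝ} (h : 0 ≤ f) : 0 ≤ (m.avg ^ k) f := by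
  have := m.avg_pow_mono k h
  rwa [map_zero] at this

theorem avg_pow_of_harmonic {f : Z → ℝ} (h : m.avg f = f) (k : ℕ) : (m.avg ^ k) f = f := by
  induction k with
  | zero => rfl
  | succ k ih => rw [avg_pow_succ, ih, h]

theorem avg_pow_le_of_superharmonic {f : Z → ℝ} (h : m.avg f ≤ f) (k : ℕ) :
    (m.avg ^ (k + 1)) f ≤ (m.avg ^ k) f := by
  rw [avg_pow_succ']; exact m.avg_pow_mono k h

theorem avg_pow_le_one (k : ℕ) {f : Z → ℝ} (h : ∀ z, f z ≤ 1) (z : Z) :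
    (m.avg ^ k) f z ≤ 1 := by
  have := m.avg_pow_mono k (f := f) (f' := fun _ => 1) h z
  rwa [avg_pow_const] at this

theorem sum_avg_pow_sub (n : ℕ) (f : Z → ℝ) :
    ∑ k ∈ Finset.range n, (m.avg ^ k) (f - m.avg f) = f - (m.avg ^ n) f := by
  induction n with
  | zero => simp
  | succ n ih => rw [Finset.sum_range_succ, ih, map_sub, ← avg_pow_succ']; abel

/-- The orbit map is equivariant, so averages over any action become averages over `Γ`, where
inversion is available. -/
theorem avg_pow_comp_smul (k : ℕ) (f : Z → ℝ) (z : Z) (h : Γ) :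
    (m.avg ^ k) (fun h' : Γ => f (h' • z)) h = (m.avg ^ k) f (h • z) := by
  induction k generalizing h with
  | zero => rfl
  | succ k ih =>
    rw [avg_pow_succ, avg_pow_succ, avg_apply, avg_apply]
    refine Finset.sum_congr rfl fun g _ => ?_
    rw [ih, smul_eq_mul, mul_smul]

theorem avg_pow_eq_avg_pow_orbit (k : ℕ) (f : Z → ℝ) (z : Z) :
    (m.avg ^ k) f z = (m.avg ^ k) (fun h : Γ => f (h • z)) 1 := by
  rw [avg_pow_comp_smul, one_smul]

theorem avg_pow_right_mul (k : ℕ) (f : Γ → ℝ) (a h : Γ) :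
    (m.avg ^ k) (fun h' => f (h' * a)) h = (m.avg ^ k) f (h * a) :=
  m.avg_pow_comp_smul k f a h

theorem avg_pow_succ_one (k : ℕ) (f : Γ → ℝ) :
    (m.avg ^ (k + 1)) f 1 =
      ∑ g ∈ m.supp, m.weight g * (m.avg ^ k) (fun h => f (h * g)) 1 := by
  rw [avg_pow_succ, avg_apply]
  refine Finset.sum_congr rfl fun g _ => ?_
  rw [avg_pow_right_mul, one_mul, smul_eq_mul, mul_one]

theorem sum_supp_inv (f : Γ → ℝ) :
    ∑ g ∈ m.supp, m.weight g * f g⁻¹ = ∑ g ∈ m.supp, m.weight g * f g := by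
  refine Finset.sum_bij' (fun g _ => g⁻¹) (fun g _ => g⁻¹) (fun g hg => m.inv_mem g hg)
    (fun g hg => m.inv_mem g hg) (by simp) (by simp) fun g _ => ?_
  rw [m.weight_inv]

/-- Inversion reverses the order of the factors: peeling the rightmost factor off the inverted
product matches peeling the leftmost off the original one, up to `g ↔ g⁻¹`, which preserves the
weights. -/
theorem avg_pow_inv (k : ℕ) (f : Γ → ℝ) :
    (m.avg ^ k) (fun h => f h⁻¹) 1 = (m.avg ^ k) f 1 := by
  induction k generalizing f with
  | zero => simp
  | succ k ih =>
    rw [avg_pow_succ_one, avg_pow_succ']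
    have h1 : ∀ g, (m.avg ^ k) (fun h : Γ => f (h * g)⁻¹) 1 =
        (m.avg ^ k) (fun h => f (g⁻¹ * h)) 1 := by
      intro g
      rw [← ih (fun h => f (g⁻¹ * h))]
      simp only [mul_inv_rev]
    simp only [h1]
    rw [m.sum_supp_inv (fun g => (m.avg ^ k) (fun h => f (g * h)) 1)]
    have h2 : m.avg f = ∑ g ∈ m.supp, m.weight g • fun h => f (g * h) := by
      funext h
      simp [avg_apply]
    rw [h2, map_sum]
    simp

theorem avg_pow_congr_finset (k : ℕ) (z : Z) :
    ∃ T : Finset Z, ∀ f f' : Z → ℝ, (∀ x ∈ T, f x = f' x) →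
      (m.avg ^ k) f z = (m.avg ^ k) f' z := by
  classical
  induction k generalizing z with
  | zero => exact ⟨{z}, fun f f' h => h z (by simp)⟩
  | succ k ih =>
    choose T hT using ih
    refine ⟨m.supp.biUnion fun g => T (g • z), fun f f' h => ?_⟩
    rw [avg_pow_succ, avg_pow_succ, avg_apply, avg_apply]
    refine Finset.sum_congr rfl fun g hg => ?_
    rw [hT (g • z) f f' fun x hx => h x (Finset.mem_biUnion.2 ⟨g, hg, hx⟩)]

/-- Irreducibility of the walk on orbits: every element is a word in the support, and the weights
along the word multiply to `q`. The pair `(k, q)` does not depend on `f` or `z`. -/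
theorem exists_le_avg_pow (Z : Type*) [MulAction Γ Z] (h : Γ) :
    ∃ (k : ℕ) (q : ℝ), 0 < q ∧ ∀ f : Z → ℝ, 0 ≤ f → ∀ z, q * f (h • z) ≤ (m.avg ^ k) f z := by
  let R : Γ → Prop := fun h => ∃ (k : ℕ) (q : ℝ), 0 < q ∧
    ∀ f : Z → ℝ, 0 ≤ f → ∀ z, q * f (h • z) ≤ (m.avg ^ k) f z
  have hs : ∀ g ∈ m.supp, R g := by
    refine fun g hg => ⟨1, m.weight g, m.weight_pos g hg, fun f hf z => ?_⟩
    rw [pow_one, avg_apply]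
    exact Finset.single_le_sum (f := fun g => m.weight g * f (g • z))
      (fun g hg => mul_nonneg (m.weight_pos g hg).le (hf _)) hg
  have hmul : ∀ a b, R a → R b → R (a * b) := by
    rintro a b ⟨k, q, hq, hk⟩ ⟨l, r, hr, hl⟩
    refine ⟨l + k, r * q, mul_pos hr hq, fun f hf z => ?_⟩
    rw [avg_pow_add]
    calc r * q * f ((a * b) • z) = r * (q * f (a • b • z)) := by rw [mul_smul]; ring
      _ ≤ r * (m.avg ^ k) f (b • z) := mul_le_mul_of_nonneg_left (hk f hf _) hr.le
      _ ≤ _ := hl _ (m.avg_pow_nonneg k hf) z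
  have key : ∀ h ∈ Subgroup.closure (m.supp : Set Γ), R h ∧ R h⁻¹ := by
    intro h hh
    induction hh using Subgroup.closure_induction with
    | mem g hg => exact ⟨hs g hg, hs _ (m.inv_mem g hg)⟩
    | one =>
      have : R 1 := ⟨0, 1, one_pos, fun f _ z => by simp⟩
      exact ⟨this, by rwa [inv_one]⟩
    | mul a b _ _ ha hb => exact ⟨hmul _ _ ha.1 hb.1, by rw [mul_inv_rev]; exact hmul _ _ hb.2 ha.2⟩
    | inv a _ ha => exact ⟨ha.2, by rw [inv_inv]; exact ha.1⟩
  exact (key h (by rw [m.closure_supp]; trivial)).1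

/-- Maximum principle: `α - u` is nonnegative and harmonic, and it vanishes at `z`, so no point
reachable from `z` can carry a positive value. -/
theorem eq_of_harmonic_of_le {u : Z → ℝ} (hu : m.avg u = u) {α : ℝ} (hle : ∀ z, u z ≤ α)
    {z : Z} (hz : u z = α) (h : Γ) : u (h • z) = α := by
  obtain ⟨k, q, hq, hk⟩ := m.exists_le_avg_pow Z h
  have h1 := hk ((fun _ => α) - u) (fun z => sub_nonneg.2 (hle z)) z
  rw [map_sub, m.avg_pow_const, m.avg_pow_of_harmonic hu] at h1
  simp only [Pi.sub_apply, hz, sub_self] at h1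
  have h2 : α - u (h • z) ≤ 0 := nonpos_of_mul_nonpos_right h1 hq
  exact le_antisymm (hle _) (by linarith)

theorem avg_min_le {u : Z → ℝ} (hu : m.avg u = u) (α : ℝ) :
    m.avg (fun z => min (u z) α) ≤ fun z => min (u z) α := by
  intro z
  refine le_min ?_ ?_
  · have := m.avg_mono (f := fun z => min (u z) α) (f' := u) (fun z => min_le_left _ _) z
    rwa [hu] at this
  · have := m.avg_mono (f := fun z => min (u z) α) (f' := fun _ => α)
      (fun z => min_le_right _ _) z
    rwa [avg_const] at this

/-- Each point reaches `U` along one fixed word, and so do its neighbours by continuity; compactness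
leaves finitely many words. -/
theorem exists_le_sum_avg_pow_of_isCompact [TopologicalSpace Z] [ContinuousConstSMul Γ Z]
    {K U : Set Z} (hK : IsCompact K) (hU : IsOpen U) (hKU : ∀ z ∈ K, ∃ h : Γ, h • z ∈ U) :
    ∃ (N : ℕ) (q : ℝ), 0 < q ∧
      ∀ z ∈ K, q ≤ ∑ i ∈ Finset.range N, (m.avg ^ i) (U.indicator fun _ => 1) z := by
  have hnn : (0 : Z → ℝ) ≤ U.indicator fun _ => 1 :=
    Set.indicator_nonneg fun _ _ => zero_le_one
  refine hK.induction_on (p := fun S => ∃ (N : ℕ) (q : ℝ), 0 < q ∧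
      ∀ z ∈ S, q ≤ ∑ i ∈ Finset.range N, (m.avg ^ i) (U.indicator fun _ => 1) z)
    ⟨0, 1, one_pos, by simp⟩ ?_ ?_ ?_
  · rintro s t hst ⟨N, q, hq, h⟩
    exact ⟨N, q, hq, fun z hz => h z (hst hz)⟩
  · rintro s t ⟨N, q, hq, h⟩ ⟨N', q', hq', h'⟩
    have hmono : ∀ {a b : ℕ}, a ≤ b → ∀ z,
        ∑ i ∈ Finset.range a, (m.avg ^ i) (U.indicator fun _ => 1) z ≤
        ∑ i ∈ Finset.range b, (m.avg ^ i) (U.indicator fun _ => 1) z := fun hab z =>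
      Finset.sum_le_sum_of_subset_of_nonneg (Finset.range_mono hab)
        fun i _ _ => m.avg_pow_nonneg i hnn z
    refine ⟨max N N', min q q', lt_min hq hq', ?_⟩
    rintro z (hz | hz)
    · exact (min_le_left _ _).trans ((h z hz).trans (hmono (le_max_left _ _) z))
    · exact (min_le_right _ _).trans ((h' z hz).trans (hmono (le_max_right _ _) z))
  · intro z hz
    obtain ⟨h, hh⟩ := hKU z hz
    obtain ⟨k, q, hq, hk⟩ := m.exists_le_avg_pow Z h
    refine ⟨(fun z => h • z) ⁻¹' U, mem_nhdsWithin_of_mem_nhds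
      ((hU.preimage (continuous_const_smul h)).mem_nhds hh), k + 1, q, hq, fun y hy => ?_⟩
    have h1 := hk _ hnn y
    rw [Set.indicator_of_mem (show h • y ∈ U from hy), mul_one] at h1
    exact h1.trans (Finset.single_le_sum
      (f := fun i => (m.avg ^ i) (U.indicator fun _ => 1) y)
      (fun i _ => m.avg_pow_nonneg i hnn y) (Finset.self_mem_range_succ k))

end Averaging

end SymmetricLaw

/-! ### Order-preserving actions on the line and step functions. -/

theorem homeoPlus_strictMono (f : HomeoPlus) : StrictMono fun x : ℝ => f • x := f.2

theorem homeoPlus_continuous (f : HomeoPlus) : Continuous fun x : ℝ => f • x :=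
  (f : ℝ ≃ₜ ℝ).continuous

instance homeoPlusContinuousConstSMul : ContinuousConstSMul HomeoPlus ℝ :=
  ⟨homeoPlus_continuous⟩

instance subgroupContinuousConstSMul (G : Subgroup HomeoPlus) : ContinuousConstSMul G ℝ :=
  ⟨fun g => homeoPlus_continuous g⟩

section Order

variable {G : Subgroup HomeoPlus}

theorem subgroup_strictMono (g : G) : StrictMono fun x : ℝ => g • x := homeoPlus_strictMono g

theorem subgroup_smul_lt (g : G) {x y : ℝ} : g • x < g • y ↔ x < y :=
  (subgroup_strictMono g).lt_iff_lt

theorem subgroup_smul_le (g : G) {x y : ℝ} : g • x ≤ g • y ↔ x ≤ y :=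
  (subgroup_strictMono g).le_iff_le

theorem subgroup_lt_smul (g : G) {x y : ℝ} : x < g • y ↔ g⁻¹ • x < y := by
  rw [← subgroup_smul_lt g⁻¹, inv_smul_smul]

theorem subgroup_smul_lt' (g : G) {x y : ℝ} : g • x < y ↔ x < g⁻¹ • y := by
  rw [← subgroup_smul_lt g⁻¹, inv_smul_smul]

theorem subgroup_le_smul (g : G) {x y : ℝ} : x ≤ g • y ↔ g⁻¹ • x ≤ y := by
  rw [← subgroup_smul_le g⁻¹, inv_smul_smul]

theorem subgroup_smul_le' (g : G) {x y : ℝ} : g • x ≤ y ↔ x ≤ g⁻¹ • y := by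
  rw [← subgroup_smul_le g⁻¹, inv_smul_smul]

end Order

/-- The step function `1_{(t, ∞)}`. -/
noncomputable def stepAbove (t : ℝ) : ℝ → ℝ := (Set.Ioi t).indicator fun _ => 1

theorem stepAbove_apply (t x : ℝ) : stepAbove t x = if t < x then 1 else 0 := by
  simp [stepAbove, Set.indicator_apply]

theorem stepAbove_monotone (t : ℝ) : Monotone (stepAbove t) := by
  intro x y h
  rw [stepAbove_apply, stepAbove_apply]
  split_ifs <;> linarith

theorem indicator_one_nonneg {Z : Type*} (S : Set Z) :
    (0 : Z → ℝ) ≤ S.indicator fun _ => 1 :=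
  Set.indicator_nonneg fun _ _ => zero_le_one

theorem indicator_one_le_one {Z : Type*} (S : Set Z) (z : Z) :
    S.indicator (fun _ => (1 : ℝ)) z ≤ 1 := Set.indicator_le_self' (fun _ _ => zero_le_one) z

/-! ### Recurrence of the symmetric walk on the line. -/

namespace SymmetricLaw

variable {G : Subgroup HomeoPlus} (m : SymmetricLaw G)

theorem avg_pow_monotone (k : ℕ) {f : ℝ → ℝ} (hf : Monotone f) : Monotone ((m.avg ^ k) f) := by
  induction k with
  | zero => exact hf
  | succ k ih =>
    rw [avg_pow_succ]
    intro x y hxy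
    exact Finset.sum_le_sum fun g hg =>
      mul_le_mul_of_nonneg_left (ih ((subgroup_smul_le g).2 hxy)) (m.weight_pos g hg).le

/-- Expected number of visits to `S` before time `n` of the walk started at `t`. -/
noncomputable def green (n : ℕ) (t : ℝ) (S : Set ℝ) : ℝ :=
  ∑ k ∈ Finset.range n, (m.avg ^ k) (S.indicator fun _ => 1) t

/-- Duality: `h x ≤ t < h y` holds exactly when `x ≤ h⁻¹ t < y`, and `h` and `h⁻¹` have the same law
after `k` steps. -/
theorem avg_pow_stepAbove_sub (k : ℕ) (t : ℝ) {x y : ℝ} (hxy : x ≤ y) :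
    (m.avg ^ k) (stepAbove t) y - (m.avg ^ k) (stepAbove t) x =
      (m.avg ^ k) ((Set.Ico x y).indicator fun _ => 1) t := by
  rw [m.avg_pow_eq_avg_pow_orbit k _ t, ← m.avg_pow_inv k, m.avg_pow_eq_avg_pow_orbit k _ x,
    m.avg_pow_eq_avg_pow_orbit k _ y, ← Pi.sub_apply, ← map_sub]
  refine congrArg (fun f => (m.avg ^ k) f 1) (funext fun h => ?_)
  simp only [Pi.sub_apply, stepAbove_apply, Set.indicator_apply, Set.mem_Ico]
  simp only [subgroup_le_smul, subgroup_smul_lt' h⁻¹, inv_inv]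
  have := (subgroup_smul_le h).2 hxy
  rcases lt_or_ge t (h • x) with h1 | h1
  · simp [h1, h1.not_ge, h1.trans_le this]
  · simp [h1, h1.not_gt]

theorem green_eq (n : ℕ) (t : ℝ) {x y : ℝ} (hxy : x ≤ y) :
    m.green n t (Set.Ico x y) = ∑ k ∈ Finset.range n,
      ((m.avg ^ k) (stepAbove t) y - (m.avg ^ k) (stepAbove t) x) :=
  Finset.sum_congr rfl fun k _ => (m.avg_pow_stepAbove_sub k t hxy).symm

theorem green_mono_set (n : ℕ) (t : ℝ) {S S' : Set ℝ} (h : S ⊆ S') :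
    m.green n t S ≤ m.green n t S' :=
  Finset.sum_le_sum fun k _ => m.avg_pow_mono k
    (fun z => Set.indicator_le_indicator_of_subset h (fun _ => zero_le_one) z) t

theorem green_mono {n n' : ℕ} (h : n ≤ n') (t : ℝ) (S : Set ℝ) :
    m.green n t S ≤ m.green n' t S :=
  Finset.sum_le_sum_of_subset_of_nonneg (Finset.range_mono h)
    fun k _ _ => m.avg_pow_nonneg k (indicator_one_nonneg S) t

theorem green_nonneg (n : ℕ) (t : ℝ) (S : Set ℝ) : 0 ≤ m.green n t S :=
  Finset.sum_nonneg fun k _ => m.avg_pow_nonneg k (indicator_one_nonneg S) t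

/-- The events `h t > t` and `h t < t` are exchanged by inversion, hence equally likely. -/
theorem two_mul_avg_pow_stepAbove_self (k : ℕ) (t : ℝ) :
    2 * (m.avg ^ k) (stepAbove t) t + (m.avg ^ k) (({t} : Set ℝ).indicator fun _ => 1) t = 1 := by
  have h1 : (m.avg ^ k) (stepAbove t) t = (m.avg ^ k) ((Set.Iio t).indicator fun _ => 1) t := by
    rw [m.avg_pow_eq_avg_pow_orbit k _ t, ← m.avg_pow_inv k, m.avg_pow_eq_avg_pow_orbit k _ t]
    refine congrArg (fun f => (m.avg ^ k) f 1) (funext fun h => ?_)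
    simp only [stepAbove_apply, Set.indicator_apply, Set.mem_Iio]
    simp only [subgroup_lt_smul, inv_inv]
  have h2 : stepAbove t + (Set.Iio t).indicator (fun _ => 1) +
      ({t} : Set ℝ).indicator (fun _ => 1) = fun _ => (1 : ℝ) := by
    funext x
    simp only [Pi.add_apply, stepAbove_apply, Set.indicator_apply, Set.mem_Iio,
      Set.mem_singleton_iff]
    rcases lt_trichotomy t x with h | h | h
    · simp [h, h.not_gt, h.ne']
    · simp [h]
    · simp [h, h.not_gt, h.ne]
  have h3 := congrFun (m.avg_pow_const k 1) t
  rw [← h2, map_add, map_add] at h3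
  simp only [Pi.add_apply] at h3
  rw [two_mul]
  nth_rewrite 2 [h1]
  exact h3

/-- The potential kernel drifts inward at speed `1/2` when the walk is transient. -/
theorem exists_potential_of_summable (t : ℝ)
    (hsum : ∀ x y, x ≤ y → Summable fun k => (m.avg ^ k) ((Set.Ico x y).indicator fun _ => 1) t) :
    ∃ H : ℝ → ℝ, Monotone H ∧ H t = 0 ∧ ∀ x, m.avg H x = H x + 1 / 2 - stepAbove t x := by
  have hsum' : ∀ x, Summable fun k => (m.avg ^ k) (stepAbove t) x - (m.avg ^ k) (stepAbove t) t := by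
    intro x
    rcases le_total t x with h | h
    · simpa only [m.avg_pow_stepAbove_sub _ t h] using hsum t x h
    · have := (hsum x t h).neg
      simp only [← m.avg_pow_stepAbove_sub _ t h, neg_sub] at this
      exact this
  have hself : Tendsto (fun k => (m.avg ^ k) (stepAbove t) t) atTop (𝓝 (1 / 2)) := by
    have h0 : Tendsto (fun k => (m.avg ^ k) (({t} : Set ℝ).indicator fun _ => 1) t) atTop (𝓝 0) :=
      squeeze_zero (fun k => m.avg_pow_nonneg k (indicator_one_nonneg _) t)
        (fun k => m.avg_pow_mono k (fun z => Set.indicator_le_indicator_of_subset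
          (s := {t}) (t := Set.Ico t (t + 1)) (by simp) (fun _ => zero_le_one) z) t)
        (hsum t (t + 1) (by linarith)).tendsto_atTop_zero
    have h1 := (tendsto_const_nhds (x := (1 : ℝ))).sub h0
    have h2 := h1.div_const 2
    rw [sub_zero] at h2
    refine h2.congr fun k => ?_
    have := m.two_mul_avg_pow_stepAbove_self k t
    linarith
  have hlim : ∀ x, Tendsto (fun k => (m.avg ^ k) (stepAbove t) x) atTop (𝓝 (1 / 2)) := by
    intro x
    have := (hsum' x).tendsto_atTop_zero.add hself
    simpa using this
  have hH : ∀ x, Tendsto (fun n => ∑ k ∈ Finset.range n,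
      ((m.avg ^ k) (stepAbove t) x - (m.avg ^ k) (stepAbove t) t)) atTop
      (𝓝 (∑' k, ((m.avg ^ k) (stepAbove t) x - (m.avg ^ k) (stepAbove t) t))) :=
    fun x => (hsum' x).hasSum.tendsto_sum_nat
  refine ⟨fun x => ∑' k, ((m.avg ^ k) (stepAbove t) x - (m.avg ^ k) (stepAbove t) t), ?_, ?_, ?_⟩
  · intro x y hxy
    exact (hsum' x).tsum_le_tsum (fun k => sub_le_sub_right
      (m.avg_pow_monotone k (stepAbove_monotone t) hxy) _) (hsum' y)
  · simp
  · intro x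
    have h1 : Tendsto (fun n => m.avg (fun x => ∑ k ∈ Finset.range n,
        ((m.avg ^ k) (stepAbove t) x - (m.avg ^ k) (stepAbove t) t)) x) atTop
        (𝓝 (m.avg (fun x => ∑' k, ((m.avg ^ k) (stepAbove t) x -
          (m.avg ^ k) (stepAbove t) t)) x)) := by
      simp only [avg_apply]
      exact tendsto_finsetSum _ fun g _ => (hH (g • x)).const_mul _
    -- Applying `avg` shifts the powers by one, so the partial sums telescope; the surviving term
    -- `P^n 1_{(t, ∞)}` tends to `1/2`.
    have h2 : ∀ n, m.avg (fun x => ∑ k ∈ Finset.range n,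
        ((m.avg ^ k) (stepAbove t) x - (m.avg ^ k) (stepAbove t) t)) x =
        ∑ k ∈ Finset.range n, ((m.avg ^ k) (stepAbove t) x - (m.avg ^ k) (stepAbove t) t) +
        (m.avg ^ n) (stepAbove t) x - stepAbove t x := by
      intro n
      have h3 : (fun x => ∑ k ∈ Finset.range n,
        ((m.avg ^ k) (stepAbove t) x - (m.avg ^ k) (stepAbove t) t)) =
        ∑ k ∈ Finset.range n, ((m.avg ^ k) (stepAbove t) -
          fun _ => (m.avg ^ k) (stepAbove t) t) := by
        funext x; simp
      rw [h3, map_sum]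
      simp only [map_sub, avg_const, ← avg_pow_succ, Finset.sum_apply, Pi.sub_apply,
        Finset.sum_sub_distrib]
      have h4 := Finset.sum_range_succ (fun k => (m.avg ^ k) (stepAbove t) x) n
      rw [Finset.sum_range_succ'] at h4
      simp only [pow_zero, Module.End.one_apply] at h4
      linarith
    refine tendsto_nhds_unique h1 ?_
    simp only [h2]
    exact ((hH x).add (hlim x)).sub_const _

/-- A symmetric walk on the line is recurrent in the mean. -/
theorem exists_not_summable (t : ℝ) : ∃ x y, x ≤ y ∧
    ¬ Summable fun k => (m.avg ^ k) ((Set.Ico x y).indicator fun _ => 1) t := by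
  by_contra! hcon
  obtain ⟨H, hmono, hzero, hdrift⟩ := m.exists_potential_of_summable t hcon
  obtain ⟨R, hR⟩ : ∃ R, ∀ g ∈ m.supp, |g • t - t| < R :=
    ⟨∑ g ∈ m.supp, |g • t - t| + 1, fun g hg => (Finset.single_le_sum
      (f := fun g => |g • t - t|) (fun g _ => abs_nonneg _) hg).trans_lt (by linarith)⟩
  obtain ⟨B, hB0, hB⟩ : ∃ B, 0 ≤ B ∧ ∀ g ∈ m.supp, |H (g • t)| ≤ B :=
    ⟨∑ g ∈ m.supp, |H (g • t)|, Finset.sum_nonneg fun g _ => abs_nonneg _,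
      fun g hg => Finset.single_le_sum (f := fun g => |H (g • t)|) (fun g _ => abs_nonneg _) hg⟩
  have hsupp : m.supp.Nonempty := by
    rw [Finset.nonempty_iff_ne_empty]
    intro h
    simpa [h] using m.sum_weight
  have hR0 : 0 < R := by
    obtain ⟨g, hg⟩ := hsupp
    exact (abs_nonneg _).trans_lt (hR g hg)
  set K := Set.Ico (t - R) (t + R) with hK
  set W : ℝ → ℝ := fun x => |H x| with hW
  -- Outside `K` no support element carries `x` across `t`, so `H` keeps its sign and `|H|` inherits
  -- the drift `-1/2`. A crossing starts inside `K`, and monotonicity bounds the value after it by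
  -- `B`, whence the correction `2 * B`.
  have hstep : m.avg W ≤ W + (2 * B) • (K.indicator fun _ => (1 : ℝ)) - fun _ => 1 / 2 := by
    intro x
    simp only [Pi.sub_apply, Pi.add_apply, Pi.smul_apply, smul_eq_mul]
    have hd := hdrift x
    rw [stepAbove_apply] at hd
    have hpos : ∀ {z}, t ≤ z → 0 ≤ H z := fun h => hzero ▸ hmono h
    have hneg : ∀ {z}, z ≤ t → H z ≤ 0 := fun h => hzero ▸ hmono h
    have hsumw : ∀ c : ℝ, ∑ g ∈ m.supp, m.weight g * c = c := fun c => by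
      rw [← Finset.sum_mul, m.sum_weight, one_mul]
    by_cases hx : t < x
    · rw [if_pos hx] at hd
      have : ∀ g ∈ m.supp, m.weight g * W (g • x) ≤
          m.weight g * H (g • x) + m.weight g * (2 * B * K.indicator (fun _ => (1 : ℝ)) x) := by
        intro g hg
        rw [← mul_add]
        refine mul_le_mul_of_nonneg_left ?_ (m.weight_pos g hg).le
        rcases le_total t (g • x) with h | h
        · rw [hW]
          simp only [abs_of_nonneg (hpos h)]
          have : 0 ≤ 2 * B * K.indicator (fun _ => (1 : ℝ)) x :=
            mul_nonneg (mul_nonneg zero_le_two hB0) (indicator_one_nonneg K x)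
          linarith
        · have hxK : x ∈ K := by
            rw [subgroup_smul_le'] at h
            have := (abs_lt.1 (hR _ (m.inv_mem g hg))).2
            exact ⟨by linarith, by linarith⟩
          rw [Set.indicator_of_mem hxK, hW]
          simp only [abs_of_nonpos (hneg h)]
          have h1 : H (g • t) ≤ H (g • x) := hmono ((subgroup_smul_le g).2 hx.le)
          have h2 := (abs_le.1 (hB g hg)).1
          linarith
      have h1 := Finset.sum_le_sum this
      rw [Finset.sum_add_distrib, hsumw, ← avg_apply, ← avg_apply] at h1
      have h2 : W x = H x := abs_of_nonneg (hpos hx.le)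
      linarith
    · rw [if_neg hx] at hd
      push Not at hx
      have : ∀ g ∈ m.supp, m.weight g * W (g • x) ≤
          m.weight g * (2 * B * K.indicator (fun _ => (1 : ℝ)) x) - m.weight g * H (g • x) := by
        intro g hg
        rw [← mul_sub]
        refine mul_le_mul_of_nonneg_left ?_ (m.weight_pos g hg).le
        rcases lt_or_ge t (g • x) with h | h
        · have hxK : x ∈ K := by
            rw [subgroup_lt_smul] at h
            have := (abs_lt.1 (hR _ (m.inv_mem g hg))).1
            exact ⟨by linarith, by linarith⟩
          rw [Set.indicator_of_mem hxK, hW]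
          simp only [abs_of_nonneg (hpos h.le)]
          have h1 : H (g • x) ≤ H (g • t) := hmono ((subgroup_smul_le g).2 hx)
          have h2 := (abs_le.1 (hB g hg)).2
          linarith
        · rw [hW]
          simp only [abs_of_nonpos (hneg h)]
          have : 0 ≤ 2 * B * K.indicator (fun _ => (1 : ℝ)) x :=
            mul_nonneg (mul_nonneg zero_le_two hB0) (indicator_one_nonneg K x)
          linarith
      have h1 := Finset.sum_le_sum this
      rw [Finset.sum_sub_distrib, hsumw, ← avg_apply, ← avg_apply] at h1
      have h2 : W x = - H x := abs_of_nonpos (hneg hx)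
      linarith
  have hiter : ∀ n : ℕ, (m.avg ^ n) W t ≤ 2 * B * m.green n t K - n / 2 := by
    intro n
    induction n with
    | zero => simp [hW, hzero, green]
    | succ n ih =>
      have h1 := m.avg_pow_mono n hstep t
      rw [← avg_pow_succ', map_sub, map_add, map_smul, avg_pow_const] at h1
      simp only [Pi.sub_apply, Pi.add_apply, Pi.smul_apply, smul_eq_mul] at h1
      have h2 : m.green (n + 1) t K = m.green n t K + (m.avg ^ n) (K.indicator fun _ => 1) t :=
        Finset.sum_range_succ _ _
      rw [h2]
      push_cast
      linarith
  have hbound : ∀ n : ℕ, (n : ℝ) / 2 ≤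
      2 * B * ∑' k, (m.avg ^ k) (K.indicator fun _ => 1) t := by
    intro n
    have h1 : (0 : ℝ) ≤ (m.avg ^ n) W t := m.avg_pow_nonneg n (fun _ => abs_nonneg _) t
    have h0 := hiter n
    have h2 : m.green n t K ≤ ∑' k, (m.avg ^ k) (K.indicator fun _ => 1) t :=
      (hcon _ _ (by linarith)).sum_le_tsum _
        fun k _ => m.avg_pow_nonneg k (indicator_one_nonneg K) t
    have h3 := mul_le_mul_of_nonneg_left h2 (mul_nonneg zero_le_two hB0)
    linarith
  obtain ⟨n, hn⟩ := exists_nat_gt (2 * (2 * B * ∑' k, (m.avg ^ k) (K.indicator fun _ => 1) t))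
  have := hbound n
  linarith

/-- From any point of `[x, y]` minimality gives a probability bounded below of visiting `(a, b)`
within `N` steps, and a time shift by at most `N` changes the visit count by at most `N`. The
constants are uniform in `n` and `t`. -/
theorem exists_green_le (hmin : MulAction.IsMinimal G ℝ) {a b : ℝ} (hab : a < b) (x y : ℝ) :
    ∃ C D : ℝ, 0 ≤ C ∧ ∀ n t, m.green n t (Set.Icc x y) ≤ C * (m.green n t (Set.Ioo a b) + D) := by
  obtain ⟨N, q, hq, h⟩ := m.exists_le_sum_avg_pow_of_isCompact (isCompact_Icc (a := x) (b := y))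
    (isOpen_Ioo (a := a) (b := b)) fun z _ => by
      obtain ⟨w, hw, g, rfl⟩ := (MulAction.dense_orbit G z).inter_open_nonempty _ isOpen_Ioo
        (Set.nonempty_Ioo.2 hab)
      exact ⟨g, hw⟩
  set I := (Set.Ioo a b).indicator fun _ => (1 : ℝ) with hI
  have hle : (Set.Icc x y).indicator (fun _ => (1 : ℝ)) ≤
      q⁻¹ • ∑ i ∈ Finset.range N, (m.avg ^ i) I := by
    intro z
    simp only [Pi.smul_apply, Finset.sum_apply, smul_eq_mul]
    by_cases hz : z ∈ Set.Icc x y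
    · rw [Set.indicator_of_mem hz, inv_mul_eq_div, le_div_iff₀ hq, one_mul]
      exact h z hz
    · rw [Set.indicator_of_notMem hz]
      exact mul_nonneg (inv_nonneg.2 hq.le) (Finset.sum_nonneg fun i _ =>
        m.avg_pow_nonneg i (indicator_one_nonneg _) z)
  refine ⟨q⁻¹ * N, N, by positivity, fun n t => ?_⟩
  have hshift : ∀ i ≤ N, ∑ k ∈ Finset.range n, (m.avg ^ (k + i)) I t ≤
      m.green n t (Set.Ioo a b) + N := by
    intro i hi
    have h1 : ∑ k ∈ Finset.range n, (m.avg ^ (k + i)) I t ≤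
        ∑ k ∈ Finset.range (n + i), (m.avg ^ k) I t := by
      rw [add_comm n i, Finset.sum_range_add]
      simp only [add_comm _ i]
      exact le_add_of_nonneg_left (m.green_nonneg i t _)
    have h2 : ∑ k ∈ Finset.range (n + i), (m.avg ^ k) I t ≤ m.green n t (Set.Ioo a b) + i := by
      rw [Finset.sum_range_add]
      refine add_le_add le_rfl ?_
      refine (Finset.sum_le_card_nsmul _ _ 1 fun j _ =>
        m.avg_pow_le_one _ (indicator_one_le_one _) t).trans ?_
      simp
    have h3 : (i : ℝ) ≤ N := by exact_mod_cast hi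
    linarith
  calc m.green n t (Set.Icc x y)
      ≤ ∑ k ∈ Finset.range n, (m.avg ^ k) (q⁻¹ • ∑ i ∈ Finset.range N, (m.avg ^ i) I) t :=
        Finset.sum_le_sum fun k _ => m.avg_pow_mono k hle t
    _ = q⁻¹ * ∑ i ∈ Finset.range N, ∑ k ∈ Finset.range n, (m.avg ^ (k + i)) I t := by
        rw [Finset.sum_comm, Finset.mul_sum]
        refine Finset.sum_congr rfl fun k _ => ?_
        simp [map_smul, map_sum, avg_pow_add]
    _ ≤ q⁻¹ * ∑ i ∈ Finset.range N, (m.green n t (Set.Ioo a b) + N) :=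
        mul_le_mul_of_nonneg_left (Finset.sum_le_sum fun i hi =>
          hshift i (Finset.mem_range.1 hi).le) (inv_nonneg.2 hq.le)
    _ = _ := by simp; ring

theorem tendsto_green_atTop (hmin : MulAction.IsMinimal G ℝ) {a b : ℝ} (hab : a < b) (t : ℝ) :
    Tendsto (fun n => m.green n t (Set.Ioo a b)) atTop atTop := by
  obtain ⟨x, y, hxy, hns⟩ := m.exists_not_summable t
  obtain ⟨C, D, hC, hle⟩ := m.exists_green_le hmin hab x y
  have hmono : Monotone fun n => m.green n t (Set.Ioo a b) := fun _ _ h => m.green_mono h t _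
  refine (tendsto_atTop_of_monotone hmono).resolve_right ?_
  rintro ⟨l, hl⟩
  refine hns (summable_of_sum_range_le (c := C * (l + D))
    (fun k => m.avg_pow_nonneg k (indicator_one_nonneg _) t) fun n => ?_)
  calc _ = m.green n t (Set.Ico x y) := rfl
    _ ≤ m.green n t (Set.Icc x y) := m.green_mono_set n t Set.Ico_subset_Icc_self
    _ ≤ C * (m.green n t (Set.Ioo a b) + D) := hle n t
    _ ≤ _ := mul_le_mul_of_nonneg_left (add_le_add_left (hmono.ge_of_tendsto hl n) D) hC

end SymmetricLaw

/-! ### Monotone functions that are harmonic up to a constant. -/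

/-- The distance between the coordinates of a pair, measured in the coordinate `F`. -/
def pairDist (F : ℝ → ℝ) (z : ℝ × ℝ) : ℝ := |F z.2 - F z.1|

/-- The jump of `F` at `x`. -/
noncomputable def jump (F : ℝ → ℝ) (x : ℝ) : ℝ := Function.rightLim F x - Function.leftLim F x

theorem jump_nonneg {F : ℝ → ℝ} (hF : Monotone F) (x : ℝ) : 0 ≤ jump F x :=
  sub_nonneg.2 (hF.leftLim_le_rightLim le_rfl)

theorem sum_jump_le {F : ℝ → ℝ} (hF : Monotone F) (a : ℝ) (S : Finset ℝ) :
    ∀ b, a < b → (∀ x ∈ S, a < x ∧ x < b) → ∑ x ∈ S, jump F x ≤ F b - F a := by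
  -- With the left limit at `b` the induction closes: the points below `x` account for growth up to
  -- the left limit at `x`, and the jump at `x` for the rest.
  suffices h : ∀ b, a < b → (∀ x ∈ S, a < x ∧ x < b) →
      ∑ x ∈ S, jump F x ≤ Function.leftLim F b - F a from fun b hab hS =>
    (h b hab hS).trans (sub_le_sub_right (hF.leftLim_le le_rfl) _)
  induction S using Finset.induction_on_max with
  | empty =>
    intro b hab _
    simpa using hF.le_leftLim hab
  | insert x S hx ih =>
    intro b hab hS
    rw [Finset.sum_insert fun h => lt_irrefl _ (hx x h)]
    have hxb := hS x (Finset.mem_insert_self x S)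
    have h1 := ih x hxb.1 fun y hy => ⟨(hS y (Finset.mem_insert_of_mem hy)).1, hx y hy⟩
    have h2 := hF.rightLim_le_leftLim hxb.2
    rw [jump]
    linarith

/-- By minimality every point has a translate inside a given flat interval, so one flat interval
would make `F` locally constant, hence constant on the connected line. -/
theorem strictMono_of_flats_invariant {G : Subgroup HomeoPlus} (hmin : MulAction.IsMinimal G ℝ)
    {F : ℝ → ℝ} (hF : Monotone F) (hflat : ∀ u v, F u = F v → ∀ h : G, F (h • u) = F (h • v))
    {a b : ℝ} (hne : F a ≠ F b) : StrictMono F := by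
  refine hF.strictMono_of_injective ?_
  by_contra hinj
  obtain ⟨u, v, huv, hlt⟩ : ∃ u v, F u = F v ∧ u < v := by
    rw [Function.Injective] at hinj
    push Not at hinj
    obtain ⟨u, v, huv, hne⟩ := hinj
    rcases hne.lt_or_gt with h | h
    exacts [⟨u, v, huv, h⟩, ⟨v, u, huv.symm, h⟩]
  have hloc : IsLocallyConstant F := by
    rw [IsLocallyConstant.iff_eventually_eq]
    intro z
    obtain ⟨w, hw, g, rfl⟩ := (MulAction.dense_orbit G z).inter_open_nonempty _ isOpen_Ioo
      (Set.nonempty_Ioo.2 hlt)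
    have h1 : g⁻¹ • u < z := by rw [← subgroup_lt_smul]; exact hw.1
    have h2 : z < g⁻¹ • v := by rw [← subgroup_smul_lt']; exact hw.2
    have h3 := hflat u v huv g⁻¹
    filter_upwards [Ioo_mem_nhds h1 h2] with y hy
    have := hF h1.le
    have := hF h2.le
    have := hF hy.1.le
    have := hF hy.2.le
    linarith
  exact hne (hloc.apply_eq_of_isPreconnected isPreconnected_univ (Set.mem_univ _)
    (Set.mem_univ _))

namespace SymmetricLaw

variable {G : Subgroup HomeoPlus} (m : SymmetricLaw G)

/-- The constant `c` cancels in differences, and increasing maps never change the sign of `F y - F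
x`, so the absolute value is harmless. -/
theorem avg_pairDist {F : ℝ → ℝ} (hF : Monotone F) {c : ℝ} (hharm : ∀ x, m.avg F x = F x + c) :
    m.avg (pairDist F) = pairDist F := by
  have key : ∀ x y, x ≤ y → ∑ g ∈ m.supp, m.weight g * (F (g • y) - F (g • x)) = F y - F x := by
    intro x y _
    have h1 := hharm x
    have h2 := hharm y
    rw [avg_apply] at h1 h2
    simp only [mul_sub, Finset.sum_sub_distrib]
    linarith
  funext ⟨x, y⟩
  rw [avg_apply]
  simp only [pairDist, Prod.smul_mk]
  rcases le_total x y with h | h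
  · rw [abs_of_nonneg (sub_nonneg.2 (hF h)), ← key x y h]
    refine Finset.sum_congr rfl fun g _ => ?_
    rw [abs_of_nonneg (sub_nonneg.2 (hF ((subgroup_smul_le g).2 h)))]
  · rw [abs_of_nonpos (sub_nonpos.2 (hF h)), neg_sub, ← key y x h]
    refine Finset.sum_congr rfl fun g _ => ?_
    rw [abs_of_nonpos (sub_nonpos.2 (hF ((subgroup_smul_le g).2 h))), neg_sub]

/-- A pair with `F u = F v` is a zero of the nonnegative harmonic function `pairDist F`, and zeros
propagate along orbits of pairs. -/
theorem strictMono_of_harmonic (hmin : MulAction.IsMinimal G ℝ) {F : ℝ → ℝ} (hF : Monotone F)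
    {c : ℝ} (hharm : ∀ x, m.avg F x = F x + c) {a b : ℝ} (hne : F a ≠ F b) : StrictMono F := by
  refine strictMono_of_flats_invariant hmin hF (fun u v huv h => ?_) hne
  obtain ⟨k, q, hq, hk⟩ := m.exists_le_avg_pow (ℝ × ℝ) h
  have h1 := hk (pairDist F) (fun _ => abs_nonneg _) (u, v)
  rw [m.avg_pow_of_harmonic (m.avg_pairDist hF hharm)] at h1
  simp only [pairDist, huv, sub_self, abs_zero, Prod.smul_mk] at h1
  have h2 := nonpos_of_mul_nonpos_right h1 hq
  have h3 := abs_eq_zero.1 (le_antisymm h2 (abs_nonneg _))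
  linarith

theorem avg_jump {F : ℝ → ℝ} (hF : Monotone F) {c : ℝ} (hharm : ∀ x, m.avg F x = F x + c) :
    m.avg (jump F) = jump F := by
  have hright : ∀ x, m.avg (Function.rightLim F) x = Function.rightLim F x + c := by
    intro x
    have h1 : Tendsto (m.avg F) (𝓝[>] x) (𝓝 (m.avg (Function.rightLim F) x)) := by
      refine tendsto_finsetSum _ fun g _ => Tendsto.const_mul _ ?_
      refine (hF.tendsto_rightLim (g • x)).comp (tendsto_nhdsWithin_iff.2
        ⟨((continuous_const_smul g).tendsto x).mono_left nhdsWithin_le_nhds, ?_⟩)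
      filter_upwards [self_mem_nhdsWithin] with y hy
      exact (subgroup_smul_lt g).2 hy
    have h2 : Tendsto (m.avg F) (𝓝[>] x) (𝓝 (Function.rightLim F x + c)) :=
      ((hF.tendsto_rightLim x).add_const c).congr fun y => (hharm y).symm
    exact tendsto_nhds_unique h1 h2
  have hleft : ∀ x, m.avg (Function.leftLim F) x = Function.leftLim F x + c := by
    intro x
    have h1 : Tendsto (m.avg F) (𝓝[<] x) (𝓝 (m.avg (Function.leftLim F) x)) := by
      refine tendsto_finsetSum _ fun g _ => Tendsto.const_mul _ ?_
      refine (hF.tendsto_leftLim (g • x)).comp (tendsto_nhdsWithin_iff.2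
        ⟨((continuous_const_smul g).tendsto x).mono_left nhdsWithin_le_nhds, ?_⟩)
      filter_upwards [self_mem_nhdsWithin] with y hy
      exact (subgroup_smul_lt g).2 hy
    have h2 : Tendsto (m.avg F) (𝓝[<] x) (𝓝 (Function.leftLim F x + c)) :=
      ((hF.tendsto_leftLim x).add_const c).congr fun y => (hharm y).symm
    exact tendsto_nhds_unique h1 h2
  have h : jump F = Function.rightLim F - Function.leftLim F := rfl
  funext x
  rw [h, map_sub, Pi.sub_apply, hright, hleft, Pi.sub_apply]
  ring

theorem avg_pow_singleton (k : ℕ) (x z : ℝ) :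
    (m.avg ^ k) (({z} : Set ℝ).indicator fun _ => 1) x =
      (m.avg ^ k) (({x} : Set ℝ).indicator fun _ => 1) z := by
  rw [m.avg_pow_eq_avg_pow_orbit k _ z, ← m.avg_pow_inv k, m.avg_pow_eq_avg_pow_orbit k _ x]
  refine congrArg (fun f => (m.avg ^ k) f 1) (funext fun h => ?_)
  simp only [Set.indicator_apply, Set.mem_singleton_iff, inv_smul_eq_iff, eq_comm (a := z)]

/-- A nonnegative function whose Green potential is dominated by a function that is summable on
an interval vanishes. -/
theorem eq_zero_of_potential_le (hmin : MulAction.IsMinimal G ℝ) {w J : ℝ → ℝ} (hw : 0 ≤ w)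
    {a b C : ℝ} (hab : a < b)
    (hpot : ∀ n x, ∑ k ∈ Finset.range n, (m.avg ^ k) w x ≤ J x)
    (hJ : ∀ S : Finset ℝ, (∀ x ∈ S, x ∈ Set.Ioo a b) → ∑ x ∈ S, J x ≤ C) : w = 0 := by
  classical
  funext z
  by_contra hz
  have hz0 : 0 < w z := lt_of_le_of_ne (hw z) (Ne.symm hz)
  -- The point kernel is symmetric, so visits from `z` to points of `(a, b)` can be counted as
  -- visits from those points to `z`; weighted by `w z`, the latter are dominated by the potential
  -- of `w`, hence by `J`.
  have hbound : ∀ n, w z * m.green n z (Set.Ioo a b) ≤ C := by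
    intro n
    choose T hT using fun k => m.avg_pow_congr_finset (Z := ℝ) k z
    set S : Finset ℝ := ((Finset.range n).biUnion T).filter (· ∈ Set.Ioo a b) with hS
    refine le_trans ?_ (hJ S fun x hx => (Finset.mem_filter.1 hx).2)
    refine le_trans ?_ (Finset.sum_le_sum fun x _ => hpot n x)
    rw [Finset.sum_comm, green, Finset.mul_sum]
    refine Finset.sum_le_sum fun k hk => ?_
    have h1 : (m.avg ^ k) ((Set.Ioo a b).indicator fun _ => 1) z =
        ∑ x ∈ S, (m.avg ^ k) (({x} : Set ℝ).indicator fun _ => 1) z := by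
      rw [← Finset.sum_apply, ← map_sum]
      refine hT k _ _ fun x hx => ?_
      rw [Finset.sum_apply]
      by_cases hxK : x ∈ Set.Ioo a b
      · have hxS : x ∈ S := Finset.mem_filter.2 ⟨Finset.mem_biUnion.2 ⟨k, hk, hx⟩, hxK⟩
        rw [Set.indicator_of_mem hxK, Finset.sum_eq_single_of_mem x hxS]
        · simp
        · intro y _ hy
          simp [hy.symm]
      · rw [Set.indicator_of_notMem hxK]
        refine (Finset.sum_eq_zero fun y hy => ?_).symm
        have : x ≠ y := fun h => hxK (h ▸ (Finset.mem_filter.1 hy).2)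
        simp [this]
    rw [h1, Finset.mul_sum]
    refine Finset.sum_le_sum fun x _ => ?_
    rw [← m.avg_pow_singleton]
    have h2 := m.avg_pow_mono k (f := w z • (({z} : Set ℝ).indicator fun _ => 1)) (f' := w)
      (fun y => by
        by_cases hy : y = z
        · simp [hy]
        · simpa [hy] using hw y) x
    rw [map_smul] at h2
    exact h2
  obtain ⟨n, hn⟩ := ((m.tendsto_green_atTop hmin hab z).eventually_gt_atTop (C / w z)).exists
  rw [div_lt_iff₀ hz0, mul_comm] at hn
  exact absurd (hbound n) (not_le.2 hn)

/-- The jump function is harmonic and summable on `(0, 1)`. Truncated at the height `α` of one jump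
it is superharmonic, and its defect has a potential below the jump function, so the defect vanishes.
The maximum principle then puts a jump of size at least `α` at every point of a dense orbit,
contradicting summability. -/
theorem continuous_of_harmonic (hmin : MulAction.IsMinimal G ℝ) {F : ℝ → ℝ} (hF : Monotone F)
    {c : ℝ} (hharm : ∀ x, m.avg F x = F x + c) : Continuous F := by
  have hJ := m.avg_jump hF hharm
  have hsum : ∀ S : Finset ℝ, (∀ x ∈ S, x ∈ Set.Ioo (0 : ℝ) 1) → ∑ x ∈ S, jump F x ≤ F 1 - F 0 :=
    fun S hS => sum_jump_le hF 0 S 1 one_pos hS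
  suffices h0 : ∀ x, jump F x = 0 by
    refine continuous_iff_continuousAt.2 fun x => hF.continuousAt_iff_leftLim_eq_rightLim.2 ?_
    exact (sub_eq_zero.1 (h0 x)).symm
  intro x₀
  by_contra hne
  have hpos : 0 < jump F x₀ := lt_of_le_of_ne (jump_nonneg hF x₀) (Ne.symm hne)
  set α := jump F x₀ with hα
  set u : ℝ → ℝ := fun x => min (jump F x) α with hu
  have hle : m.avg u ≤ u := m.avg_min_le hJ α
  have hu0 : 0 ≤ u := fun x => le_min (jump_nonneg hF x) hpos.le
  have hzero := m.eq_zero_of_potential_le hmin (w := u - m.avg u) (J := jump F)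
    (sub_nonneg.2 hle) one_pos (fun n x => by
      rw [← Finset.sum_apply, m.sum_avg_pow_sub, Pi.sub_apply]
      have : 0 ≤ (m.avg ^ n) u x := m.avg_pow_nonneg n hu0 x
      have := min_le_left (jump F x) α
      simp only [hu]
      linarith) hsum
  have hharmu : m.avg u = u := (sub_eq_zero.1 hzero).symm
  have horb : ∀ h : G, α ≤ jump F (h • x₀) := by
    intro h
    have := m.eq_of_harmonic_of_le hharmu (α := α) (fun z => min_le_right _ _) (z := x₀)
      (min_self _) h
    rw [← this]
    exact min_le_left _ _
  have hinf : (MulAction.orbit G x₀ ∩ Set.Ioo (0 : ℝ) 1).Infinite := by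
    intro hfin
    obtain ⟨y, hy, hyo, hyn⟩ := ((MulAction.dense_orbit G x₀).sdiff_finite hfin).inter_open_nonempty
      (Set.Ioo (0 : ℝ) 1) isOpen_Ioo (Set.nonempty_Ioo.2 one_pos)
    exact hyn ⟨hyo, hy⟩
  obtain ⟨N, hN⟩ := exists_nat_gt ((F 1 - F 0) / α)
  obtain ⟨S, hS, hcard⟩ := hinf.exists_subset_card_eq N
  have h1 := hsum S fun x hx => (hS hx).2
  have h2 : ∑ x ∈ S, α ≤ ∑ x ∈ S, jump F x := Finset.sum_le_sum fun x hx => by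
    obtain ⟨h, rfl⟩ := (hS hx).1
    exact horb h
  rw [Finset.sum_const, hcard, nsmul_eq_mul] at h2
  rw [div_lt_iff₀ hpos] at hN
  linarith

/-- If `F ≤ s`, then `s - F` is nonnegative and harmonic. By recurrence its truncation at the value
at `0` has no defect, so the maximum principle gives `F (h • 0) ≤ F 0` for every `h`. Using `h⁻¹` as
well, `0` would be a global fixed point. -/
theorem not_bddAbove_of_harmonic (hmin : MulAction.IsMinimal G ℝ) (hirr : IsIrreducibleAction G)
    {F : ℝ → ℝ} (hF : StrictMono F) (hcont : Continuous F) (hharm : m.avg F = F) :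
    ¬ BddAbove (Set.range F) := by
  rintro ⟨s, hs⟩
  have hs' : ∀ x, F x ≤ s := fun x => hs ⟨x, rfl⟩
  set u : ℝ → ℝ := (fun _ => s) - F with hu
  have hharmu : m.avg u = u := by rw [hu, map_sub, avg_const, hharm]
  have hu0 : 0 ≤ u := fun x => sub_nonneg.2 (hs' x)
  set α := u 0 with hα
  set v : ℝ → ℝ := fun x => min (u x) α with hv
  have hle : m.avg v ≤ v := m.avg_min_le hharmu α
  have hv0 : 0 ≤ v := fun x => le_min (hu0 x) (hu0 0)
  have hvc : Continuous v := (continuous_const.sub hcont).min continuous_const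
  have hwc : Continuous (v - m.avg v) :=
    hvc.sub (continuous_finsetSum _ fun g _ =>
      continuous_const.mul (hvc.comp (continuous_const_smul g)))
  have hharmv : m.avg v = v := by
    by_contra hne
    obtain ⟨z, hz⟩ : ∃ z, 0 < (v - m.avg v) z := by
      by_contra! hcon
      exact hne (le_antisymm hle fun z => sub_nonpos.1 (hcon z))
    set δ := (v - m.avg v) z / 2 with hδ
    have hδ0 : 0 < δ := half_pos hz
    obtain ⟨a, b, hzab, hsub⟩ := mem_nhds_iff_exists_Ioo_subset.1
      ((isOpen_Ioi.preimage hwc).mem_nhds (show δ < (v - m.avg v) z from half_lt_self hz))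
    have hab : a < b := hzab.1.trans hzab.2
    obtain ⟨n, hn⟩ := ((m.tendsto_green_atTop hmin hab 0).eventually_gt_atTop (α / δ)).exists
    rw [div_lt_iff₀ hδ0] at hn
    have h1 : (m.green n 0 (Set.Ioo a b)) * δ ≤
        ∑ k ∈ Finset.range n, (m.avg ^ k) (v - m.avg v) 0 := by
      rw [green, Finset.sum_mul]
      refine Finset.sum_le_sum fun k _ => ?_
      have h2 := m.avg_pow_mono k (f := δ • ((Set.Ioo a b).indicator fun _ => 1))
        (f' := v - m.avg v) (fun y => by
          by_cases hy : y ∈ Set.Ioo a b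
          · have : δ < (v - m.avg v) y := hsub hy
            simpa [hy] using this.le
          · simpa [hy] using hle y) 0
      rw [map_smul, Pi.smul_apply, smul_eq_mul, mul_comm] at h2
      exact h2
    rw [← Finset.sum_apply, m.sum_avg_pow_sub, Pi.sub_apply] at h1
    have h3 : 0 ≤ (m.avg ^ n) v 0 := m.avg_pow_nonneg n hv0 0
    have h4 : v 0 ≤ α := min_le_right _ _
    linarith
  have hfix : ∀ h : G, h • (0 : ℝ) ≤ 0 := by
    intro h
    have := m.eq_of_harmonic_of_le hharmv (α := α) (fun z => min_le_right _ _) (z := 0)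
      (min_self _) h
    have h1 : α ≤ u (h • 0) := this ▸ min_le_left _ _
    simp only [hα, hu, Pi.sub_apply] at h1
    exact hF.le_iff_le.1 (by linarith)
  obtain ⟨g, hg⟩ := hirr 0
  refine hg (le_antisymm (hfix g) ?_)
  rw [subgroup_le_smul]
  exact hfix g⁻¹

end SymmetricLaw

/-! ### Construction of the coordinates as limits of normalized potentials. -/

theorem exists_pointwise_ultrafilter_limit (f : ℕ → ℝ → ℝ) (hb : ∀ x, ∃ C, ∀ n, |f n x| ≤ C) :
    ∃ F : ℝ → ℝ, ∀ x, Tendsto (fun n => f n x) (hyperfilter ℕ : Filter ℕ) (𝓝 (F x)) := by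
  have h : ∀ x, ∃ l, Tendsto (fun n => f n x) (hyperfilter ℕ : Filter ℕ) (𝓝 l) := by
    intro x
    obtain ⟨C, hC⟩ := hb x
    obtain ⟨l, -, hl⟩ := (isCompact_Icc (a := -C) (b := C)).ultrafilter_le_nhds
      ((hyperfilter ℕ).map fun n => f n x)
      (by
        rw [Ultrafilter.coe_map, le_principal_iff]
        exact Filter.mem_map.2 (univ_mem' fun n => abs_le.1 (hC n)))
    exact ⟨l, hl⟩
  choose F hF using h
  exact ⟨F, hF⟩

theorem hyperfilter_nat_le_atTop : (hyperfilter ℕ : Filter ℕ) ≤ atTop :=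
  Nat.hyperfilter_le_atTop

namespace SymmetricLaw

variable {G : Subgroup HomeoPlus} (m : SymmetricLaw G)

/-- The normalized potentials `(∑_{k < n} (P^k ρ - P^k ρ(0))) / a_n`. -/
noncomputable def potential (ρ : ℝ → ℝ) (a : ℕ → ℝ) (n : ℕ) (x : ℝ) : ℝ :=
  (∑ k ∈ Finset.range n, ((m.avg ^ k) ρ x - (m.avg ^ k) ρ 0)) / a n

theorem potential_monotone {ρ : ℝ → ℝ} (hρ : Monotone ρ) {a : ℕ → ℝ} (ha : ∀ n, 0 ≤ a n) (n : ℕ) :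
    Monotone (m.potential ρ a n) := fun _ _ hxy =>
  div_le_div_of_nonneg_right (Finset.sum_le_sum fun k _ =>
    sub_le_sub_right (m.avg_pow_monotone k hρ hxy) _) (ha n)

theorem avg_potential (ρ : ℝ → ℝ) (a : ℕ → ℝ) (n : ℕ) (x : ℝ) :
    m.avg (m.potential ρ a n) x = m.potential ρ a n x + ((m.avg ^ n) ρ x - ρ x) / a n := by
  have h3 : m.potential ρ a n = (a n)⁻¹ • ∑ k ∈ Finset.range n, ((m.avg ^ k) ρ -
      fun _ => (m.avg ^ k) ρ 0) := by
    funext x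
    simp [potential, div_eq_inv_mul]
  have h4 := Finset.sum_range_succ (fun k => (m.avg ^ k) ρ x) n
  rw [Finset.sum_range_succ'] at h4
  simp only [pow_zero, Module.End.one_apply] at h4
  have h5 : ∑ k ∈ Finset.range n, (m.avg ^ (k + 1)) ρ x =
    ∑ k ∈ Finset.range n, (m.avg ^ k) ρ x + (m.avg ^ n) ρ x - ρ x := by linarith
  rw [h3, map_smul, map_sum]
  simp only [map_sub, avg_const, ← avg_pow_succ, Finset.sum_apply, Pi.sub_apply,
    Finset.sum_sub_distrib, Pi.smul_apply, smul_eq_mul, h5]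
  ring

theorem tendsto_avg {ι : Type*} {l : Filter ι} {f : ι → ℝ → ℝ} {F : ℝ → ℝ}
    (h : ∀ x, Tendsto (fun i => f i x) l (𝓝 (F x))) (x : ℝ) :
    Tendsto (fun i => m.avg (f i) x) l (𝓝 (m.avg F x)) :=
  tendsto_finsetSum _ fun g _ => (h (g • x)).const_mul _

/-- The coordinate in which the walk is a martingale. -/
theorem exists_martingale_coordinate (hmin : MulAction.IsMinimal G ℝ)
    (hirr : IsIrreducibleAction G) :
    ∃ F : ℝ → ℝ, StrictMono F ∧ Continuous F ∧ m.avg F = F ∧ ¬ BddAbove (Set.range F) := by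
  set ρ := stepAbove 0 with hρ
  -- This normalization forces `F 0 = 0` and `F 1 = 1`, so the limit is not constant.
  set a : ℕ → ℝ := fun n => m.green n 0 (Set.Ico 0 1) with ha
  have ha0 : ∀ n, 0 ≤ a n := fun n => m.green_nonneg n 0 _
  have ha1 : ∀ n, 1 ≤ n → 1 ≤ a n := fun n hn =>
    le_trans (by simp [green]) (m.green_mono hn 0 (Set.Ico 0 1))
  have hatop : Tendsto a atTop atTop :=
    tendsto_atTop_mono (fun n => m.green_mono_set n 0 Set.Ioo_subset_Ico_self)
      (m.tendsto_green_atTop hmin one_pos 0)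
  have hpot : ∀ n x, 0 ≤ x → m.potential ρ a n x = m.green n 0 (Set.Ico 0 x) / a n :=
    fun n x hx => by rw [potential, m.green_eq n 0 hx]
  have hpot' : ∀ n x, x ≤ 0 → m.potential ρ a n x = -(m.green n 0 (Set.Ico x 0) / a n) :=
    fun n x hx => by
      rw [potential, m.green_eq n 0 hx, ← neg_div, ← Finset.sum_neg_distrib]
      simp only [neg_sub, hρ]
  have hbd : ∀ x y, ∃ C, ∀ n, m.green n 0 (Set.Ico x y) / a n ≤ C := by
    intro x y
    obtain ⟨C, D, hC, h⟩ := m.exists_green_le hmin one_pos x y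
    refine ⟨C * (1 + |D|), fun n => ?_⟩
    rcases Nat.eq_zero_or_pos n with rfl | hn
    · simp [green]; positivity
    · have h1 := ha1 n hn
      rw [div_le_iff₀ (by linarith)]
      calc _ ≤ m.green n 0 (Set.Icc x y) := m.green_mono_set n 0 Set.Ico_subset_Icc_self
        _ ≤ C * (m.green n 0 (Set.Ioo 0 1) + D) := h n 0
        _ ≤ C * (a n + |D| * a n) := by
          refine mul_le_mul_of_nonneg_left (add_le_add
            (m.green_mono_set n 0 Set.Ioo_subset_Ico_self) ?_) hC
          exact (le_abs_self D).trans (le_mul_of_one_le_right (abs_nonneg D) h1)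
        _ = _ := by ring
  -- The ratio bounds allow a limit along one ultrafilter for all `x` at once, with no subsequence
  -- depending on `x`.
  obtain ⟨F, hF⟩ := exists_pointwise_ultrafilter_limit (m.potential ρ a) fun x => by
    rcases le_total 0 x with hx | hx
    · obtain ⟨C, hC⟩ := hbd 0 x
      refine ⟨C, fun n => ?_⟩
      rw [hpot n x hx, abs_of_nonneg (div_nonneg (m.green_nonneg _ _ _) (ha0 n))]
      exact hC n
    · obtain ⟨C, hC⟩ := hbd x 0
      refine ⟨C, fun n => ?_⟩
      rw [hpot' n x hx, abs_neg, abs_of_nonneg (div_nonneg (m.green_nonneg _ _ _) (ha0 n))]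
      exact hC n
  have hmono : Monotone F := fun x y hxy =>
    le_of_tendsto_of_tendsto' (hF x) (hF y)
      fun n => m.potential_monotone (stepAbove_monotone 0) ha0 n hxy
  have hharm : m.avg F = F := by
    funext x
    refine tendsto_nhds_unique (m.tendsto_avg hF x) ?_
    simp only [avg_potential]
    -- The harmonicity defect is at most `1 / a n`, which vanishes by recurrence.
    have h1 : Tendsto (fun n => ((m.avg ^ n) ρ x - ρ x) / a n) atTop (𝓝 0) := by
      refine squeeze_zero_norm' (a := fun n => 1 / a n) ?_
        (Tendsto.div_atTop tendsto_const_nhds hatop)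
      refine Eventually.of_forall fun n => ?_
      rw [Real.norm_eq_abs, abs_div, abs_of_nonneg (ha0 n)]
      refine div_le_div_of_nonneg_right (abs_le.2 ?_) (ha0 n)
      have h2 := m.avg_pow_le_one n (f := ρ) (indicator_one_le_one _) x
      have h3 : 0 ≤ (m.avg ^ n) ρ x := m.avg_pow_nonneg n (indicator_one_nonneg _) x
      have h4 := indicator_one_le_one (Set.Ioi 0) x
      have h5 : 0 ≤ ρ x := indicator_one_nonneg (Set.Ioi 0) x
      have h6 : ρ x ≤ 1 := h4
      constructor <;> linarith
    simpa using (hF x).add (h1.mono_left hyperfilter_nat_le_atTop)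
  have h0 : F 0 = 0 := by
    refine tendsto_nhds_unique (hF 0) ?_
    simp [potential]
  have h1 : F 1 = 1 := by
    refine tendsto_nhds_unique (hF 1) (tendsto_const_nhds.congr' ?_)
    refine hyperfilter_nat_le_atTop ?_
    filter_upwards [eventually_ge_atTop 1] with n hn
    rw [hpot n 1 zero_le_one]
    exact (div_self (by linarith [ha1 n hn] : a n ≠ 0)).symm
  have hharm' : ∀ x, m.avg F x = F x + 0 := fun x => by rw [hharm, add_zero]
  have hstrict := m.strictMono_of_harmonic hmin hmono hharm' (a := 0) (b := 1) (by simp [h0, h1])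
  have hcont := m.continuous_of_harmonic hmin hmono hharm'
  exact ⟨F, hstrict, hcont, hharm, m.not_bddAbove_of_harmonic hmin hirr hstrict hcont hharm⟩

/-- The martingale coordinate for an action commuting with `φ⁻¹ (φ + 1)`. -/
theorem exists_periodic_coordinate (hmin : MulAction.IsMinimal G ℝ) (φ : ℝ ≃ₜ ℝ)
    (hφ : StrictMono φ) (hcomm : ∀ (g : G) (x : ℝ), φ (g • φ.symm (φ x + 1)) = φ (g • x) + 1) :
    ∃ (F : ℝ → ℝ) (c : ℝ), StrictMono F ∧ Continuous F ∧ (∀ x, m.avg F x = F x + c) ∧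
      ∀ x, F (φ.symm (φ x + 1)) = F x + 1 := by
  set T : ℝ → ℝ := fun x => φ.symm (φ x + 1) with hT
  have hTφ : ∀ x, φ (T x) = φ x + 1 := fun x => φ.apply_symm_apply _
  have hTg : ∀ (g : G) x, g • T x = T (g • x) := fun g x => by
    rw [hT]
    simp only
    rw [← hcomm g x, φ.symm_apply_apply]
  have hper : ∀ k x, (m.avg ^ k) φ (T x) = (m.avg ^ k) φ x + 1 := by
    intro k
    induction k with
    | zero => exact hTφ
    | succ k ih =>
      intro x
      rw [avg_pow_succ, avg_apply, avg_apply]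
      simp only [hTg, ih, mul_add, Finset.sum_add_distrib, mul_one, m.sum_weight]
  have hper' : ∀ (N : ℕ) k x, (m.avg ^ k) φ (T^[N] x) = (m.avg ^ k) φ x + N := by
    intro N k
    induction N with
    | zero => simp
    | succ N ih =>
      intro x
      rw [Function.iterate_succ_apply', hper, ih]
      push_cast
      ring
  -- Every `P^k φ` gains exactly `1` under `T`, so its increment from `x` to `y` is at most the
  -- number of iterates of `T` needed to pass `y`.
  have hbd : ∀ x y, ∃ C, ∀ k, |(m.avg ^ k) φ y - (m.avg ^ k) φ x| ≤ C := by
    have aux : ∀ x y, x ≤ y → ∃ C, ∀ k, |(m.avg ^ k) φ y - (m.avg ^ k) φ x| ≤ C := by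
      intro x y hxy
      obtain ⟨N, hN⟩ := exists_nat_ge (φ y - φ x)
      refine ⟨N, fun k => ?_⟩
      have h1 : y ≤ T^[N] x := by
        rw [← hφ.le_iff_le]
        have := hper' N 0 x
        simp only [pow_zero, Module.End.one_apply] at this
        linarith
      have h2 := m.avg_pow_monotone k hφ.monotone h1
      have h3 := m.avg_pow_monotone k hφ.monotone hxy
      rw [hper'] at h2
      rw [abs_of_nonneg (sub_nonneg.2 h3)]
      linarith
    intro x y
    rcases le_total x y with h | h
    · exact aux x y h
    · obtain ⟨C, hC⟩ := aux y x h
      exact ⟨C, fun k => by rw [abs_sub_comm]; exact hC k⟩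
  obtain ⟨F, hF⟩ := exists_pointwise_ultrafilter_limit (m.potential φ fun n => (n : ℝ)) fun x => by
    obtain ⟨C, hC⟩ := hbd 0 x
    have hC0 : 0 ≤ C := (abs_nonneg _).trans (hC 0)
    refine ⟨C, fun n => ?_⟩
    rw [potential, abs_div, Nat.abs_cast]
    refine div_le_of_le_mul₀ (Nat.cast_nonneg n) hC0 ?_
    refine (Finset.abs_sum_le_sum_abs _ _).trans ?_
    refine (Finset.sum_le_card_nsmul _ _ C fun k _ => hC k).trans ?_
    simp [mul_comm]
  have hmono : Monotone F := fun x y hxy =>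
    le_of_tendsto_of_tendsto' (hF x) (hF y)
      fun n => m.potential_monotone hφ.monotone (fun n => Nat.cast_nonneg n) n hxy
  -- The defect `(P^n φ - φ) / n` need not vanish, but its values at `x` and `0` differ by `O(1/n)`.
  -- Harmonicity up to a constant suffices, since only differences of `F` are used.
  have hharm : ∀ x, m.avg F x = F x + (m.avg F 0 - F 0) := by
    intro x
    have h1 : Tendsto (fun n : ℕ => (((m.avg ^ n) φ x - φ x) - ((m.avg ^ n) φ 0 - φ 0)) / n) atTop
        (𝓝 0) := by
      obtain ⟨C, hC⟩ := hbd 0 x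
      refine squeeze_zero_norm' (a := fun n : ℕ => (2 * C) / n) ?_
        (Tendsto.div_atTop tendsto_const_nhds tendsto_natCast_atTop_atTop)
      refine Eventually.of_forall fun n => ?_
      rw [Real.norm_eq_abs, abs_div, Nat.abs_cast]
      refine div_le_div_of_nonneg_right ?_ (Nat.cast_nonneg n)
      have h2 := abs_le.1 (hC n)
      have h3 := abs_le.1 (hC 0)
      simp only [pow_zero, Module.End.one_apply] at h3
      exact abs_le.2 ⟨by linarith, by linarith⟩
    have h2 := ((m.tendsto_avg hF x).sub (hF x)).sub ((m.tendsto_avg hF 0).sub (hF 0))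
    have h3 := tendsto_nhds_unique h2 ((h1.mono_left hyperfilter_nat_le_atTop).congr fun n => by
      simp only [avg_potential]
      ring)
    linarith
  have hTF : ∀ x, F (T x) = F x + 1 := by
    intro x
    refine tendsto_nhds_unique (hF (T x)) (((hF x).add_const 1).congr' ?_)
    refine hyperfilter_nat_le_atTop ?_
    filter_upwards [eventually_ge_atTop 1] with n hn
    have hn0 : (n : ℝ) ≠ 0 := by positivity
    simp only [potential, hper]
    rw [eq_div_iff hn0, add_mul, div_mul_cancel₀ _ hn0]
    simp only [Finset.sum_sub_distrib, Finset.sum_add_distrib]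
    simp
    ring
  exact ⟨F, _, m.strictMono_of_harmonic hmin hmono hharm (a := 0) (b := T 0) (by simp [hTF]),
    m.continuous_of_harmonic hmin hmono hharm, hharm, hTF⟩

end SymmetricLaw

/-! ### From the operator to the path measure: maximal inequality and finiteness of visits. -/

instance homeoSubgroupDiscreteMeasurableSpace (G : Subgroup HomeoPlus) :
    DiscreteMeasurableSpace G := ⟨fun _ => trivial⟩

/-- Prepend an increment to a sequence of increments. -/
def consIncrement {G : Subgroup HomeoPlus} (g : G) (ω : ℕ → G) : ℕ → G
  | 0 => g
  | n + 1 => ω n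

theorem measurable_consIncrement {G : Subgroup HomeoPlus} (g : G) :
    Measurable (consIncrement g) := by
  refine measurable_pi_iff.2 fun n => ?_
  cases n with
  | zero => exact measurable_const
  | succ n => exact measurable_pi_apply n

theorem leftWalk_consIncrement {G : Subgroup HomeoPlus} (g : G) (ω : ℕ → G) (n : ℕ) :
    leftWalk (consIncrement g ω) (n + 1) = leftWalk ω n * g := by
  induction n with
  | zero => simp [leftWalk, consIncrement]
  | succ n ih =>
    rw [leftWalk, ih, leftWalk, mul_assoc]
    rfl

theorem measurable_leftWalk {G : Subgroup HomeoPlus} [Countable G] (n : ℕ) :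
    Measurable fun ω : ℕ → G => leftWalk ω n := by
  induction n with
  | zero => exact measurable_const
  | succ n ih =>
    exact (Measurable.of_discrete (f := fun p : G × G => p.1 * p.2)).comp
      ((measurable_pi_apply n).prodMk ih)

instance incrementLaw_isProbabilityMeasure {G : Subgroup HomeoPlus} (μ : PMF G) :
    IsProbabilityMeasure (incrementLaw μ) := by
  unfold incrementLaw; infer_instance

namespace SymmetricLaw

variable {G : Subgroup HomeoPlus} (m : SymmetricLaw G)

/-- `m` and the probability mass function `μ` describe the same law. -/
structure IsLawOf (μ : PMF G) : Prop where
  support_eq : μ.support = m.supp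
  apply_eq : ∀ g, μ g = ENNReal.ofReal (m.weight g)

/-- Finite generation gives countability, which makes multiplication measurable for the product of
the discrete σ-algebras. -/
theorem countable (m : SymmetricLaw G) : Countable G := by
  have hsurj : Function.Surjective (FreeGroup.lift (Subtype.val : m.supp → G)) := by
    rw [← MonoidHom.range_eq_top, FreeGroup.range_lift_eq_closure, Subtype.range_coe_subtype]
    exact m.closure_supp
  exact hsurj.countable

variable {m} {μ : PMF G}

theorem IsLawOf.toMeasure_apply (hμ : m.IsLawOf μ) (t : Set G) :
    μ.toMeasure t = ∑ g ∈ m.supp, μ g * t.indicator (fun _ => 1) g := by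
  rw [PMF.toMeasure_apply _ (MeasurableSet.of_discrete), tsum_eq_sum (s := m.supp)]
  · refine Finset.sum_congr rfl fun g _ => ?_
    by_cases h : g ∈ t <;> simp [h]
  · intro g hg
    have : g ∉ μ.support := by rw [hμ.support_eq]; simpa using hg
    have h0 : μ g = 0 := by simpa using this
    by_cases h : g ∈ t <;> simp [h, h0]

/-- The Markov property at time one: conditioning on the first increment leaves an independent copy
of the sequence. It is checked on cylinders. -/
theorem IsLawOf.incrementLaw_eq (hμ : m.IsLawOf μ) :
    incrementLaw μ = ∑ g ∈ m.supp, μ g • (incrementLaw μ).map (consIncrement g) := by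
  classical
  symm
  refine Measure.eq_infinitePi _ fun s t ht => ?_
  obtain ⟨N, hN⟩ : ∃ N, ∀ i ∈ s, i < N + 1 :=
    ⟨s.sup id, fun i hi => Nat.lt_succ_of_le (Finset.le_sup (f := id) hi)⟩
  -- Padding with `univ` turns the cylinder into one over an initial segment containing `0`, so that
  -- the first factor can be split off.
  set u : ℕ → Set G := fun i => if i ∈ s then t i else Set.univ with hu
  have hsr : s ⊆ Finset.range (N + 1) := fun i hi => Finset.mem_range.2 (hN i hi)
  have hset : Set.pi (s : Set ℕ) t = Set.pi (Finset.range (N + 1) : Set ℕ) u := by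
    ext ω
    simp only [Set.mem_pi, hu, Finset.mem_coe]
    constructor
    · intro h i _
      split_ifs with hi
      · exact h i hi
      · trivial
    · intro h i hi
      simpa [hi] using h i (hsr hi)
  have hprod : ∏ i ∈ s, μ.toMeasure (t i) = ∏ i ∈ Finset.range (N + 1), μ.toMeasure (u i) := by
    rw [← Finset.prod_subset hsr (f := fun i => μ.toMeasure (u i))]
    · exact Finset.prod_congr rfl fun i hi => by simp [hu, hi]
    · intro i _ hi
      simp [hu, hi]
  rw [hset, hprod, Finset.prod_range_succ', hμ.toMeasure_apply (u 0), Finset.mul_sum,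
    Measure.coe_finsetSum, Finset.sum_apply]
  refine Finset.sum_congr rfl fun g _ => ?_
  rw [Measure.smul_apply, smul_eq_mul, Measure.map_apply (measurable_consIncrement g)
    (MeasurableSet.pi (Finset.countable_toSet _) fun _ _ => MeasurableSet.of_discrete)]
  by_cases hg : g ∈ u 0
  · have : consIncrement g ⁻¹' Set.pi (Finset.range (N + 1) : Set ℕ) u =
        Set.pi (Finset.range N : Set ℕ) fun i => u (i + 1) := by
      ext ω
      simp only [Set.mem_preimage, Set.mem_pi, Finset.mem_coe, Finset.mem_range]
      constructor
      · intro h i hi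
        exact h (i + 1) (by omega)
      · intro h i hi
        cases i with
        | zero => exact hg
        | succ i => exact h i (by omega)
    rw [this, incrementLaw, Measure.infinitePi_pi _ fun _ _ => MeasurableSet.of_discrete,
      Set.indicator_of_mem hg]
    ring
  · have : consIncrement g ⁻¹' Set.pi (Finset.range (N + 1) : Set ℕ) u = ∅ := by
      ext ω
      simp only [Set.mem_preimage, Set.mem_pi, Finset.mem_coe, Finset.mem_range,
        Set.mem_empty_iff_false, iff_false]
      intro h
      exact hg (h 0 (by omega))
    rw [this, Set.indicator_of_notMem hg]
    simp

theorem IsLawOf.incrementLaw_apply (hμ : m.IsLawOf μ) {E : Set (ℕ → G)} (hE : MeasurableSet E) :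
    incrementLaw μ E = ∑ g ∈ m.supp, μ g * incrementLaw μ (consIncrement g ⁻¹' E) := by
  conv_lhs => rw [hμ.incrementLaw_eq]
  rw [Measure.coe_finsetSum, Finset.sum_apply]
  refine Finset.sum_congr rfl fun g _ => ?_
  rw [Measure.smul_apply, smul_eq_mul, Measure.map_apply (measurable_consIncrement g) hE]

theorem measurableSet_leftWalk_smul_mem {Z : Type*} [MulAction G Z] [Countable G] (n : ℕ) (z : Z)
    (C : Set Z) : MeasurableSet {ω : ℕ → G | leftWalk ω n • z ∈ C} :=
  measurable_leftWalk n (MeasurableSet.of_discrete (s := {g : G | g • z ∈ C}))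

theorem IsLawOf.incrementLaw_mem (hμ : m.IsLawOf μ) {Z : Type*} [MulAction G Z] (C : Set Z)
    (n : ℕ) (z : Z) :
    incrementLaw μ {ω | leftWalk ω n • z ∈ C} =
      ENNReal.ofReal ((m.avg ^ n) (C.indicator fun _ => 1) z) := by
  have := m.countable
  induction n generalizing z with
  | zero => by_cases h : z ∈ C <;> simp [leftWalk, h]
  | succ n ih =>
    rw [hμ.incrementLaw_apply (measurableSet_leftWalk_smul_mem _ z C), avg_pow_succ, avg_apply,
      ENNReal.ofReal_sum_of_nonneg fun g hg => mul_nonneg (m.weight_pos g hg).le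
        (m.avg_pow_nonneg n (indicator_one_nonneg C) _)]
    refine Finset.sum_congr rfl fun g hg => ?_
    rw [ENNReal.ofReal_mul (m.weight_pos g hg).le, ← hμ.apply_eq, ← ih]
    simp only [Set.preimage_ofPred_eq, leftWalk_consIncrement, mul_smul]

/-- The maximal inequality for nonnegative supermartingales. -/
theorem IsLawOf.incrementLaw_exists_le (hμ : m.IsLawOf μ) {Z : Type*} [MulAction G Z] {D : Z → ℝ}
    (hD : 0 ≤ D) (hharm : m.avg D ≤ D) {M : ℝ} (hM : 0 < M) (z : Z) :
    incrementLaw μ {ω | ∃ n, M ≤ D (leftWalk ω n • z)} ≤ ENNReal.ofReal (D z / M) := by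
  have := m.countable
  have hmeas : ∀ N z, MeasurableSet {ω : ℕ → G | ∃ n ≤ N, M ≤ D (leftWalk ω n • z)} := by
    intro N z
    have : {ω : ℕ → G | ∃ n ≤ N, M ≤ D (leftWalk ω n • z)} =
        ⋃ n ∈ Set.Iic N, {ω | leftWalk ω n • z ∈ {z | M ≤ D z}} := by
      ext ω; simp
    rw [this]
    exact MeasurableSet.biUnion (Set.to_countable _) fun n _ =>
      measurableSet_leftWalk_smul_mem n z _
  -- Induction on the horizon replaces a stopping time: if `M ≤ D z` the bound is at least `1`;
  -- otherwise the level is not reached at time `0` and the first step is averaged.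
  have hfin : ∀ N z, incrementLaw μ {ω | ∃ n ≤ N, M ≤ D (leftWalk ω n • z)} ≤
      ENNReal.ofReal (D z / M) := by
    intro N
    induction N with
    | zero =>
      intro z
      by_cases h : M ≤ D z
      · refine prob_le_one.trans ?_
        rw [ENNReal.one_le_ofReal, one_le_div hM]
        exact h
      · simp [leftWalk, h]
    | succ N ih =>
      intro z
      by_cases h : M ≤ D z
      · refine prob_le_one.trans ?_
        rw [ENNReal.one_le_ofReal, one_le_div hM]
        exact h
      rw [hμ.incrementLaw_apply (hmeas _ z)]
      have hpre : ∀ g : G, consIncrement g ⁻¹' {ω | ∃ n ≤ N + 1, M ≤ D (leftWalk ω n • z)} =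
          {ω | ∃ n ≤ N, M ≤ D (leftWalk ω n • g • z)} := by
        intro g
        ext ω
        simp only [Set.mem_preimage, Set.mem_ofPred_eq]
        constructor
        · rintro ⟨n, hn, hle⟩
          cases n with
          | zero => simp [leftWalk, h] at hle
          | succ n =>
            rw [leftWalk_consIncrement, mul_smul] at hle
            exact ⟨n, by omega, hle⟩
        · rintro ⟨n, hn, hle⟩
          refine ⟨n + 1, by omega, ?_⟩
          rw [leftWalk_consIncrement, mul_smul]
          exact hle
      calc _ ≤ ∑ g ∈ m.supp, μ g * ENNReal.ofReal (D (g • z) / M) :=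
            Finset.sum_le_sum fun g _ => by rw [hpre]; gcongr; exact ih _
        _ = ENNReal.ofReal (m.avg D z / M) := by
            rw [avg_apply, Finset.sum_div, ENNReal.ofReal_sum_of_nonneg fun g hg => div_nonneg
              (mul_nonneg (m.weight_pos g hg).le (hD _)) hM.le]
            refine Finset.sum_congr rfl fun g hg => ?_
            rw [hμ.apply_eq, ← ENNReal.ofReal_mul (m.weight_pos g hg).le, mul_div_assoc]
        _ ≤ _ := ENNReal.ofReal_le_ofReal (div_le_div_of_nonneg_right (hharm z) hM.le)
  have hunion : {ω : ℕ → G | ∃ n, M ≤ D (leftWalk ω n • z)} =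
      ⋃ N, {ω | ∃ n ≤ N, M ≤ D (leftWalk ω n • z)} := by
    ext ω
    simp only [Set.mem_ofPred_eq, Set.mem_iUnion]
    exact ⟨fun ⟨n, h⟩ => ⟨n, n, le_rfl, h⟩, fun ⟨_, n, _, h⟩ => ⟨n, h⟩⟩
  rw [hunion, Monotone.measure_iUnion]
  · exact iSup_le fun N => hfin N z
  · rintro a b hab ω ⟨n, hn, h⟩
    exact ⟨n, hn.trans hab, h⟩

variable (m) in
-- An `i`-step decrease splits into `i` one-step decreases, and the expected sum of each along the
-- walk telescopes to at most `f z`.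
theorem sum_avg_pow_sub_avg_pow_le {Z : Type*} [MulAction G Z] {f : Z → ℝ} (hf : 0 ≤ f)
    (hsup : m.avg f ≤ f) (i N : ℕ) (z : Z) :
    ∑ n ∈ Finset.range N, (m.avg ^ n) (f - (m.avg ^ i) f) z ≤ i * f z := by
  have hle : ∀ k, (m.avg ^ k) f z ≤ f z := by
    intro k
    induction k with
    | zero => exact le_rfl
    | succ k ih => exact (m.avg_pow_le_of_superharmonic hsup k z).trans ih
  induction i with
  | zero => simp
  | succ i ih =>
    have h1 : f - (m.avg ^ (i + 1)) f =
        (f - (m.avg ^ i) f) + ((m.avg ^ i) f - m.avg ((m.avg ^ i) f)) := by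
      rw [avg_pow_succ]; abel
    have h2 : ∑ n ∈ Finset.range N, (m.avg ^ n) ((m.avg ^ i) f - m.avg ((m.avg ^ i) f)) z =
        (m.avg ^ i) f z - (m.avg ^ N) ((m.avg ^ i) f) z := by
      rw [← Finset.sum_apply, m.sum_avg_pow_sub, Pi.sub_apply]
    have h3 : 0 ≤ (m.avg ^ N) ((m.avg ^ i) f) z := m.avg_pow_nonneg N (m.avg_pow_nonneg i hf) z
    have h4 := hle i
    simp only [h1, map_add, Pi.add_apply, Finset.sum_add_distrib] at ih ⊢
    rw [h2]
    push_cast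
    linarith

variable (m) in
theorem avg_sqrt_le {Z : Type*} [MulAction G Z] {D : Z → ℝ} (hD : 0 ≤ D) (hharm : m.avg D = D) :
    m.avg (fun z => √(D z)) ≤ fun z => √(D z) := by
  intro z
  have h := Real.strictConcaveOn_sqrt.concaveOn.le_map_sum (t := m.supp) (w := m.weight)
    (p := fun g => D (g • z)) (fun g hg => (m.weight_pos g hg).le) m.sum_weight
    (fun g _ => hD _)
  simp only [smul_eq_mul] at h
  rw [← avg_apply, hharm] at h
  exact h

/-- A set of states from which the martingale `D ≥ ε` can be made small in a uniformly bounded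
number of steps, with uniformly positive probability, is visited finitely often. -/
theorem IsLawOf.ae_eventually_notMem (hμ : m.IsLawOf μ) {Z : Type*} [MulAction G Z] {D : Z → ℝ}
    (hD : 0 ≤ D) (hharm : m.avg D = D) {ε : ℝ} (hε : 0 < ε) {C : Set Z} (hC : ∀ z ∈ C, ε ≤ D z)
    {N : ℕ} {q : ℝ} (hq : 0 < q)
    (hreach : ∀ z ∈ C, q ≤ ∑ i ∈ Finset.range N,
      (m.avg ^ i) ({z | D z < ε / 4}.indicator fun _ => 1) z) (z : Z) :
    ∀ᵐ ω ∂(incrementLaw μ), ∀ᶠ n in atTop, leftWalk ω n • z ∉ C := by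
  set θ : Z → ℝ := fun z => √(D z) with hθ
  have hθ0 : 0 ≤ θ := fun z => Real.sqrt_nonneg _
  have hsup : m.avg θ ≤ θ := m.avg_sqrt_le hD hharm
  set U : Set Z := {z | D z < ε / 4} with hU
  have hψ0 : ∀ i, 0 ≤ θ - (m.avg ^ i) θ := by
    intro i
    refine sub_nonneg.2 ?_
    induction i with
    | zero => exact le_rfl
    | succ i ih => exact (m.avg_pow_le_of_superharmonic hsup i).trans ih
  -- Average `(θ - r)² = D - 2 r θ + r²` over `i` steps: since `D` is harmonic the result is `2 r (r
  -- - P^i θ)`. On `U` one has `θ ≤ r / 2`, so the square is at least `r² / 4` there.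
  have hgap : ∀ i, ∀ z ∈ C, √ε / 8 * (m.avg ^ i) (U.indicator fun _ => 1) z ≤
      (θ - (m.avg ^ i) θ) z := by
    intro i z hz
    set r := θ z with hr
    have hrε : √ε ≤ r := Real.sqrt_le_sqrt (hC z hz)
    have hr0 : 0 < r := (Real.sqrt_pos.2 hε).trans_le hrε
    have hr2 : r ^ 2 = D z := Real.sq_sqrt (hD z)
    have h1 := m.avg_pow_mono i (f := (r ^ 2 / 4) • (U.indicator fun _ => 1))
      (f' := D - (2 * r) • θ + fun _ => r ^ 2) (fun y => by
        have hy2 : θ y ^ 2 = D y := Real.sq_sqrt (hD y)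
        simp only [Pi.smul_apply, Pi.add_apply, Pi.sub_apply, smul_eq_mul, ← hy2]
        by_cases hy : y ∈ U
        · have h2 : θ y ≤ r / 2 := by
            refine abs_le_of_sq_le_sq' ?_ (by linarith) |>.2
            have h3 : D y < ε / 4 := hy
            have h4 := hC z hz
            rw [hy2]
            nlinarith
          rw [Set.indicator_of_mem hy]
          have h5 : r / 2 * (r / 2) ≤ (r - θ y) * (r - θ y) :=
            mul_self_le_mul_self (by linarith) (by linarith)
          nlinarith
        · rw [Set.indicator_of_notMem hy]
          nlinarith [sq_nonneg (r - θ y)]) z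
    rw [map_smul, map_add, map_sub, map_smul, avg_pow_const, m.avg_pow_of_harmonic hharm] at h1
    simp only [Pi.smul_apply, Pi.add_apply, Pi.sub_apply, smul_eq_mul, ← hr2] at h1
    rw [Pi.sub_apply, ← hr]
    have h6 : 0 ≤ (m.avg ^ i) (U.indicator fun _ => 1) z :=
      m.avg_pow_nonneg i (indicator_one_nonneg U) z
    have h7 : r / 8 * (m.avg ^ i) (U.indicator fun _ => 1) z ≤ r - (m.avg ^ i) θ z := by
      have h8 : (2 * r) * (r / 8 * (m.avg ^ i) (U.indicator fun _ => 1) z) ≤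
          (2 * r) * (r - (m.avg ^ i) θ z) := by linarith
      exact le_of_mul_le_mul_left h8 (by linarith)
    refine le_trans (mul_le_mul_of_nonneg_right ?_ h6) h7
    linarith
  set κ := √ε / 8 * q with hκ
  have hκ0 : 0 < κ := mul_pos (div_pos (Real.sqrt_pos.2 hε) (by norm_num)) hq
  have hind : C.indicator (fun _ => (1 : ℝ)) ≤
      κ⁻¹ • ∑ i ∈ Finset.range N, (θ - (m.avg ^ i) θ) := by
    intro y
    simp only [Pi.smul_apply, Finset.sum_apply, smul_eq_mul]
    by_cases hy : y ∈ C
    · rw [Set.indicator_of_mem hy, inv_mul_eq_div, one_le_div hκ0]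
      calc κ ≤ √ε / 8 * ∑ i ∈ Finset.range N, (m.avg ^ i) (U.indicator fun _ => 1) y :=
            mul_le_mul_of_nonneg_left (hreach y hy) (by positivity)
        _ ≤ _ := by
          rw [Finset.mul_sum]
          exact Finset.sum_le_sum fun i _ => hgap i y hy
    · rw [Set.indicator_of_notMem hy]
      exact mul_nonneg (inv_nonneg.2 hκ0.le) (Finset.sum_nonneg fun i _ => hψ0 i y)
  -- The total expected decrease of `θ` is finite and each visit to `C` uses at least `κ`, so
  -- expected visits are bounded and Borel–Cantelli applies.
  have hbound : ∀ n, ∑ k ∈ Finset.range n, (m.avg ^ k) (C.indicator fun _ => 1) z ≤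
      κ⁻¹ * ∑ i ∈ Finset.range N, i * θ z := by
    intro n
    calc _ ≤ ∑ k ∈ Finset.range n,
          (m.avg ^ k) (κ⁻¹ • ∑ i ∈ Finset.range N, (θ - (m.avg ^ i) θ)) z :=
          Finset.sum_le_sum fun k _ => m.avg_pow_mono k hind z
      _ = κ⁻¹ * ∑ i ∈ Finset.range N, ∑ k ∈ Finset.range n, (m.avg ^ k) (θ - (m.avg ^ i) θ) z := by
          rw [Finset.sum_comm, Finset.mul_sum]
          refine Finset.sum_congr rfl fun k _ => ?_
          rw [map_smul, map_sum, Pi.smul_apply, Finset.sum_apply, smul_eq_mul]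
      _ ≤ _ := mul_le_mul_of_nonneg_left (Finset.sum_le_sum fun i _ =>
          m.sum_avg_pow_sub_avg_pow_le hθ0 hsup i n z) (inv_nonneg.2 hκ0.le)
  have hsummable := summable_of_sum_range_le
    (fun k => m.avg_pow_nonneg k (indicator_one_nonneg C) z) hbound
  refine MeasureTheory.ae_eventually_notMem (s := fun n => {ω : ℕ → G | leftWalk ω n • z ∈ C}) ?_
  simp only [hμ.incrementLaw_mem]
  exact hsummable.tsum_ofReal_ne_top

end SymmetricLaw

/-! ### The two-point motion and the main stability estimate. -/

instance subgroupContinuousConstSMulProd (G : Subgroup HomeoPlus) :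
    ContinuousConstSMul G (ℝ × ℝ) :=
  ⟨fun g => ((continuous_const_smul g).comp continuous_fst).prodMk
    ((continuous_const_smul g).comp continuous_snd)⟩

/-- Smallness of increments in a coordinate `F` along visits to a compact interval transfers to
the original coordinate. -/
theorem stableAlong_of_coordinate {F : ℝ → ℝ} (hF : StrictMono F) (hcont : Continuous F)
    {u v : ℕ → ℝ} (huv : ∀ n, u n ≤ v n) {a b : ℝ}
    (h : ∀ ε > 0, ∀ᶠ n in atTop, u n ∈ Set.Icc a b → F (v n) - F (u n) < ε) :
    StableAlong (Set.Icc a b) u v := by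
  have key : ∀ ε > 0, ∀ᶠ n in atTop, u n ∈ Set.Icc a b → v n - u n < ε := by
    intro ε hε
    rcases (Set.Icc a b).eq_empty_or_nonempty with he | hne
    · exact Eventually.of_forall fun n hn => absurd hn (by simp [he])
    -- The least increase of `F` over a step `ε` starting in `[a, b]` is attained, hence positive.
    obtain ⟨x, -, hx⟩ := (isCompact_Icc (a := a) (b := b)).exists_isMinOn hne
      (f := fun x => F (x + ε) - F x) (by fun_prop)
    have hpos : 0 < F (x + ε) - F x := sub_pos.2 (hF (by linarith))
    filter_upwards [h _ hpos] with n hn hmem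
    have h1 : F (x + ε) - F x ≤ F (u n + ε) - F (u n) := hx hmem
    have h2 : F (v n) < F (u n + ε) := by linarith [hn hmem]
    linarith [hF.lt_iff_lt.1 h2]
  refine Metric.tendsto_atTop.2 fun ε hε => ?_
  obtain ⟨N, hN⟩ := eventually_atTop.1 (key ε hε)
  refine ⟨N, fun n hn => ?_⟩
  rw [Real.dist_eq, sub_zero]
  by_cases hmem : u n ∈ Set.Icc a b
  · rw [Set.indicator_of_mem hmem, one_mul, abs_abs, abs_of_nonneg (sub_nonneg.2 (huv n))]
    exact hN n hn hmem
  · rw [Set.indicator_of_notMem hmem]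
    simpa using hε

/-- If intervals contract into a compact interval, their lengths in any continuous coordinate can
be made small. -/
theorem ContractsInto.exists_sub_lt {G : Subgroup HomeoPlus} {c d l₁ l₂ : ℝ} (hcd : c ≤ d)
    (h : ContractsInto G (Set.Icc c d) (Set.Icc l₁ l₂)) {F : ℝ → ℝ} (hF : Continuous F) {ε : ℝ}
    (hε : 0 < ε) : ∃ g : G, F (g • d) - F (g • c) < ε := by
  obtain ⟨g, hsub, hdiam⟩ := h
  obtain ⟨δ, hδ, hu⟩ := Metric.uniformContinuousOn_iff.1
    ((isCompact_Icc (a := l₁) (b := l₂)).uniformContinuousOn_of_continuous hF.continuousOn) ε hε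
  obtain ⟨n, hn⟩ := (hdiam.eventually_lt_const hδ).exists
  have hc : g n • c ∈ (fun t : ℝ => g n • t) '' Set.Icc c d := ⟨c, Set.left_mem_Icc.2 hcd, rfl⟩
  have hd : g n • d ∈ (fun t : ℝ => g n • t) '' Set.Icc c d := ⟨d, Set.right_mem_Icc.2 hcd, rfl⟩
  have hdist : dist (g n • d) (g n • c) < δ :=
    (Metric.dist_le_diam_of_mem (Metric.isBounded_Icc l₁ l₂ |>.subset (hsub n)) hd hc).trans_lt hn
  exact ⟨g n, (abs_lt.1 (hu _ (hsub n hd) _ (hsub n hc) hdist)).2⟩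

namespace SymmetricLaw

variable {G : Subgroup HomeoPlus} {m : SymmetricLaw G} {μ : PMF G}

/-- Below the barrier `M`, `hbdd` confines the pairs to a compact set and `hcontr` lets each of them
be brought close together, so pairs that stay apart recur only finitely often. The remaining paths
reach `M`, and the maximal inequality bounds their probability. -/
theorem IsLawOf.incrementLaw_not_stable_le (hμ : m.IsLawOf μ) {F : ℝ → ℝ} (hF : StrictMono F)
    (hcont : Continuous F) {c : ℝ} (hharm : ∀ x, m.avg F x = F x + c) {M : ℝ} (hM : 0 < M)
    (hbdd : ∀ b, ∃ B, ∀ u v, u ≤ b → F v - F u ≤ M → v ≤ B)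
    (hcontr : ∀ u v, u ≤ v → F v - F u ≤ M → ∀ ε > 0, ∃ g : G, F (g • v) - F (g • u) < ε)
    {x y : ℝ} (hxy : x ≤ y) :
    incrementLaw μ {ω | ¬ ∀ a b, ∀ ε > 0, ∀ᶠ n in atTop, leftWalk ω n • x ∈ Set.Icc a b →
      F (leftWalk ω n • y) - F (leftWalk ω n • x) < ε} ≤ ENNReal.ofReal ((F y - F x) / M) := by
  have hD0 : 0 ≤ pairDist F := fun _ => abs_nonneg _
  have hDharm := m.avg_pairDist hF.monotone hharm
  have hDc : Continuous (pairDist F) :=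
    ((hcont.comp continuous_snd).sub (hcont.comp continuous_fst)).abs
  have hDle : ∀ u v, u ≤ v → pairDist F (u, v) = F v - F u := fun u v h =>
    abs_of_nonneg (sub_nonneg.2 (hF.monotone h))
  -- Countably many compact sets cover all intervals and all thresholds, so one null set serves
  -- every `a`, `b`, `ε`.
  set C : ℕ → ℕ → Set (ℝ × ℝ) := fun N k => {z | z.1 ∈ Set.Icc (-(N : ℝ)) N ∧ z.1 ≤ z.2 ∧
    1 / ((k : ℝ) + 1) ≤ pairDist F z ∧ pairDist F z ≤ M} with hC
  have hae : ∀ᵐ ω ∂(incrementLaw μ), ∀ N k, ∀ᶠ n in atTop, leftWalk ω n • (x, y) ∉ C N k := by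
    refine ae_all_iff.2 fun N => ae_all_iff.2 fun k => ?_
    have hε : (0 : ℝ) < 1 / ((k : ℝ) + 1) := by positivity
    have hclosed : IsClosed (C N k) :=
      (isClosed_Icc.preimage continuous_fst).inter ((isClosed_le continuous_fst continuous_snd).inter
        ((isClosed_le continuous_const hDc).inter (isClosed_le hDc continuous_const)))
    obtain ⟨B, hB⟩ := hbdd N
    have hcompact : IsCompact (C N k) := by
      refine (isCompact_Icc (a := ((-(N : ℝ), -(N : ℝ)) : ℝ × ℝ)) (b := ((N : ℝ), B))).of_isClosed_subset
        hclosed ?_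
      rintro ⟨u, v⟩ ⟨hu, huv, -, hle⟩
      rw [hDle u v huv] at hle
      exact ⟨⟨hu.1, hu.1.trans huv⟩, ⟨hu.2, hB u v hu.2 hle⟩⟩
    obtain ⟨L, q, hq, hreach⟩ := m.exists_le_sum_avg_pow_of_isCompact hcompact
      (U := {z | pairDist F z < 1 / ((k : ℝ) + 1) / 4}) (isOpen_lt hDc continuous_const) (by
        rintro ⟨u, v⟩ ⟨hu, huv, -, hle⟩
        rw [hDle u v huv] at hle
        obtain ⟨g, hg⟩ := hcontr u v huv hle (1 / ((k : ℝ) + 1) / 4) (by positivity)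
        refine ⟨g, ?_⟩
        rw [Set.mem_ofPred_eq, Prod.smul_mk, hDle _ _ ((subgroup_smul_le g).2 huv)]
        exact hg)
    exact hμ.ae_eventually_notMem hD0 hDharm hε (fun z hz => hz.2.2.1) hq hreach (x, y)
  refine le_trans ?_ ((hμ.incrementLaw_exists_le hD0 hDharm.le hM (x, y)).trans_eq
    (by rw [hDle x y hxy]))
  refine measure_mono_ae ?_
  filter_upwards [hae] with ω hω hbad
  by_contra hlt
  refine hbad fun a b ε hε => ?_
  obtain ⟨k, hk⟩ := exists_nat_one_div_lt hε
  obtain ⟨N, hN⟩ := exists_nat_ge (max |a| |b|)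
  filter_upwards [hω N k] with n hn hmem
  by_contra! hge
  have huv : leftWalk ω n • x ≤ leftWalk ω n • y := (subgroup_smul_le _).2 hxy
  have hN1 := (le_max_left _ _).trans hN
  have hN2 := (le_max_right _ _).trans hN
  refine hn ⟨⟨?_, ?_⟩, huv, ?_, ?_⟩
  · exact (by linarith [neg_abs_le a] : -(N : ℝ) ≤ a).trans hmem.1
  · exact hmem.2.trans ((le_abs_self b).trans hN2)
  · rw [Prod.smul_mk, hDle _ _ huv]
    linarith
  · by_contra! hgt
    exact hlt ⟨n, hgt.le⟩

end SymmetricLaw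

/-! ### Contractible intervals and conjugation into the circle lifts. -/

theorem subgroup_image_Icc {G : Subgroup HomeoPlus} (g : G) (c d : ℝ) :
    (fun t : ℝ => g • t) '' Set.Icc c d = Set.Icc (g • c) (g • d) := by
  ext x
  constructor
  · rintro ⟨t, ht, rfl⟩
    exact ⟨(subgroup_smul_le g).2 ht.1, (subgroup_smul_le g).2 ht.2⟩
  · rintro ⟨h1, h2⟩
    exact ⟨g⁻¹ • x, ⟨(subgroup_smul_le' g).1 h1, (subgroup_le_smul g).1 h2⟩, smul_inv_smul g x⟩

theorem contractsInto_Icc_iff {G : Subgroup HomeoPlus} {c d l₁ l₂ : ℝ} (hcd : c ≤ d) :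
    ContractsInto G (Set.Icc c d) (Set.Icc l₁ l₂) ↔ ∃ h : ℕ → G,
      (∀ n, l₁ ≤ h n • c ∧ h n • d ≤ l₂) ∧ Tendsto (fun n => h n • d - h n • c) atTop (𝓝 0) := by
  unfold ContractsInto
  have h1 : ∀ g : G, g • c ≤ g • d := fun g => (subgroup_smul_le g).2 hcd
  simp only [subgroup_image_Icc, Real.diam_Icc (h1 _), Set.Icc_subset_Icc_iff (h1 _)]

theorem ContractsInto.mono_Icc {G : Subgroup HomeoPlus} {c d c' d' l₁ l₂ : ℝ}
    (h : ContractsInto G (Set.Icc c d) (Set.Icc l₁ l₂)) (hc : c ≤ c') (hcd : c' ≤ d')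
    (hd : d' ≤ d) : ContractsInto G (Set.Icc c' d') (Set.Icc l₁ l₂) := by
  rw [contractsInto_Icc_iff (hc.trans (hcd.trans hd))] at h
  obtain ⟨g, hg, hlim⟩ := h
  have h1 := fun n => (subgroup_smul_le (g n)).2 hc
  have h2 := fun n => (subgroup_smul_le (g n)).2 hd
  have h3 := fun n => (subgroup_smul_le (g n)).2 hcd
  refine (contractsInto_Icc_iff hcd).2 ⟨g, fun n => ⟨(hg n).1.trans (h1 n), (h2 n).trans (hg n).2⟩,
    squeeze_zero (fun n => sub_nonneg.2 (h3 n)) (fun n => ?_) hlim⟩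
  linarith [h1 n, h2 n]

theorem ContractsInto.smul_Icc {G : Subgroup HomeoPlus} {c d l₁ l₂ : ℝ} (hcd : c ≤ d)
    (h : ContractsInto G (Set.Icc c d) (Set.Icc l₁ l₂)) (g : G) :
    ContractsInto G (Set.Icc (g • c) (g • d)) (Set.Icc l₁ l₂) := by
  rw [contractsInto_Icc_iff hcd] at h
  obtain ⟨f, hf, hlim⟩ := h
  refine (contractsInto_Icc_iff ((subgroup_smul_le g).2 hcd)).2 ⟨fun n => f n * g⁻¹, ?_, ?_⟩
  · simpa only [mul_smul, inv_smul_smul] using hf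
  · simpa only [mul_smul, inv_smul_smul] using hlim

/-- The element of `Homeo⁺(ℝ)` given by a strictly monotone surjection. -/
noncomputable def homeoPlusOfStrictMono (f : ℝ → ℝ) (hf : StrictMono f)
    (hs : Function.Surjective f) : HomeoPlus :=
  ⟨(hf.orderIsoOfSurjective f hs).toHomeomorph, hf⟩

theorem homeoPlusOfStrictMono_smul (f : ℝ → ℝ) (hf : StrictMono f) (hs : Function.Surjective f)
    (x : ℝ) : homeoPlusOfStrictMono f hf hs • x = f x := rfl

/-- A homeomorphism of the line moving every point up by at least one is conjugate to the unit
translation. -/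
theorem exists_conj_translation (τ : HomeoPlus) (hτ : ∀ x : ℝ, x + 1 ≤ τ • x) :
    ∃ φ : HomeoPlus, ∀ x : ℝ, φ • (τ • x) = φ • x + 1 := by
  -- `ψ` maps `[0, 1)` linearly onto the fundamental domain `[0, τ 0)` and is extended by `ψ (y + 1)
  -- = τ (ψ y)`; the conjugacy is its inverse.
  set ψ : ℝ → ℝ := fun y => τ ^ ⌊y⌋ • ((τ • (0 : ℝ)) * Int.fract y) with hψ
  have h0 : 0 < τ • (0 : ℝ) := by linarith [hτ 0]
  have hsucc : ∀ n : ℤ, τ ^ (n + 1) • (0 : ℝ) = τ ^ n • τ • (0 : ℝ) := fun n => by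
    rw [zpow_add_one, mul_smul]
  have hstep : ∀ n : ℤ, τ ^ n • (0 : ℝ) + 1 ≤ τ ^ (n + 1) • (0 : ℝ) := fun n => by
    rw [add_comm n, zpow_one_add, mul_smul]
    exact hτ _
  have hmono : StrictMono fun n : ℤ => τ ^ n • (0 : ℝ) :=
    strictMono_int_of_lt_succ fun n => by linarith [hstep n]
  have hlo : ∀ y, τ ^ ⌊y⌋ • (0 : ℝ) ≤ ψ y := fun y =>
    (homeoPlus_strictMono _).monotone (mul_nonneg h0.le (Int.fract_nonneg y))
  have hhi : ∀ y, ψ y < τ ^ (⌊y⌋ + 1) • (0 : ℝ) := fun y => by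
    rw [hsucc]
    exact homeoPlus_strictMono _ (mul_lt_of_lt_one_right h0 (Int.fract_lt_one y))
  have hψm : StrictMono ψ := by
    intro y y' hyy
    rcases (Int.floor_mono hyy.le).eq_or_lt with h | h
    · simp only [hψ, h]
      refine homeoPlus_strictMono _ (mul_lt_mul_of_pos_left ?_ h0)
      rw [Int.fract, Int.fract, h]
      linarith
    · exact (hhi y).trans_le ((hmono.monotone (Int.add_one_le_iff.2 h)).trans (hlo y'))
  have hψs : Function.Surjective ψ := by
    intro x
    have hge : ∀ n : ℕ, (n : ℝ) ≤ τ ^ (n : ℤ) • (0 : ℝ) := by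
      intro n
      induction n with
      | zero => simp
      | succ n ih => push_cast; linarith [hstep n]
    have hle : ∀ n : ℕ, τ ^ (-(n : ℤ)) • (0 : ℝ) ≤ -(n : ℝ) := by
      intro n
      induction n with
      | zero => simp
      | succ n ih =>
        have := hstep (-((n : ℤ) + 1))
        rw [neg_add, neg_add_cancel_right] at this
        push_cast
        rw [neg_add]
        linarith
    obtain ⟨k, hk⟩ := exists_nat_ge (-x)
    obtain ⟨K, hK⟩ := exists_nat_gt x
    obtain ⟨n, hn, hmax⟩ := Int.exists_greatest_of_bdd (P := fun n => τ ^ n • (0 : ℝ) ≤ x)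
      ⟨K, fun z hz => hmono.le_iff_le.1 (hz.trans (hK.le.trans (hge K)))⟩
      ⟨-(k : ℤ), (hle k).trans (by linarith)⟩
    have hlt : x < τ ^ (n + 1) • (0 : ℝ) := by
      by_contra! hcon
      have := hmax _ hcon
      omega
    set w : ℝ := (τ ^ n)⁻¹ • x with hw
    have hxw : τ ^ n • w = x := smul_inv_smul _ _
    have hw0 : 0 ≤ w := by
      rw [← (homeoPlus_strictMono (τ ^ n)).le_iff_le]
      simpa only [hxw] using hn
    have hw1 : w < τ • (0 : ℝ) := by
      rw [← (homeoPlus_strictMono (τ ^ n)).lt_iff_lt]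
      simpa only [hxw, ← hsucc] using hlt
    have hr0 : 0 ≤ w / (τ • (0 : ℝ)) := div_nonneg hw0 h0.le
    have hr1 : w / (τ • (0 : ℝ)) < 1 := (div_lt_one h0).2 hw1
    refine ⟨n + w / (τ • (0 : ℝ)), ?_⟩
    have hfr : Int.fract (w / (τ • (0 : ℝ))) = w / (τ • (0 : ℝ)) := Int.fract_eq_self.2 ⟨hr0, hr1⟩
    have hfl : ⌊w / (τ • (0 : ℝ))⌋ = 0 := Int.floor_eq_zero_iff.2 ⟨hr0, hr1⟩
    simp only [hψ]
    rw [Int.floor_intCast_add, Int.fract_intCast_add, hfr, hfl, add_zero,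
      mul_div_cancel₀ _ h0.ne', hxw]
  refine ⟨(homeoPlusOfStrictMono ψ hψm hψs)⁻¹, fun x => ?_⟩
  rw [inv_smul_eq_iff]
  set y := (homeoPlusOfStrictMono ψ hψm hψs)⁻¹ • x with hy
  have hx : ψ y = x := by
    rw [← homeoPlusOfStrictMono_smul ψ hψm hψs, hy, smul_inv_smul]
  rw [homeoPlusOfStrictMono_smul]
  have : ψ (y + 1) = τ • ψ y := by
    simp only [hψ]
    rw [Int.floor_add_one, Int.fract_add_one, add_comm ⌊y⌋, zpow_one_add, mul_smul]
  rw [this, hx]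

/-- Weak but not strong contraction produces a homeomorphism commuting with the group: the
supremum of the right end points of contractible intervals. -/
theorem exists_commuting_of_weakContraction {G : Subgroup HomeoPlus}
    (hmin : MulAction.IsMinimal G ℝ) {l₁ l₂ : ℝ} (hl : l₁ ≤ l₂)
    (hweak : ∀ c d : ℝ, c ≤ d → d - c < 1 → ContractsInto G (Set.Icc c d) (Set.Icc l₁ l₂))
    (hns : ¬ StrongContraction G) :
    ∃ τ : HomeoPlus, (∀ x : ℝ, x + 1 ≤ τ • x) ∧ (∀ (g : G) (x : ℝ), g • τ • x = τ • g • x) ∧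
      ∀ c d : ℝ, c ≤ d → d < τ • c → ContractsInto G (Set.Icc c d) (Set.Icc l₁ l₂) := by
  set A : ℝ → Set ℝ := fun x => {y | x ≤ y ∧ ContractsInto G (Set.Icc x y) (Set.Icc l₁ l₂)} with hA
  have hAself : ∀ x, x ∈ A x := fun x => ⟨le_rfl, hweak x x le_rfl (by simp)⟩
  have hAsmul : ∀ (g : G) {x y}, y ∈ A x → g • y ∈ A (g • x) := fun g x y h =>
    ⟨(subgroup_smul_le g).2 h.1, h.2.smul_Icc h.1 g⟩
  have hAmono : ∀ {x x' y y'}, y ∈ A x → x ≤ x' → x' ≤ y' → y' ≤ y → y' ∈ A x' :=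
    fun h h1 h2 h3 => ⟨h2, h.2.mono_Icc h1 h2 h3⟩
  obtain ⟨c, d, hcd, hncd⟩ : ∃ c d : ℝ, c ≤ d ∧
      ¬ ContractsInto G (Set.Icc c d) (Set.Icc l₁ l₂) := by
    by_contra! hcon
    exact hns ⟨l₁, l₂, hl, hcon⟩
  -- Some `g` moves `x` below `c`. A contractible `[x, y]` with `g y > d` would have a contractible
  -- image containing `[c, d]`.
  have hbdd : ∀ x, BddAbove (A x) := by
    intro x
    obtain ⟨w, hw, g, rfl⟩ := (MulAction.dense_orbit G x).inter_open_nonempty _ isOpen_Iio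
      (Set.nonempty_Iio (a := c))
    refine ⟨g⁻¹ • d, fun y hy => ?_⟩
    rw [← subgroup_smul_le']
    by_contra! hlt
    exact hncd (hAmono (hAsmul g hy) (le_of_lt hw) hcd hlt.le).2
  set T : ℝ → ℝ := fun x => sSup (A x) with hT
  have hle : ∀ {x y}, y ∈ A x → y ≤ T x := fun h => le_csSup (hbdd _) h
  have hmem : ∀ {x y}, x ≤ y → y < T x → y ∈ A x := fun {x y} h1 h2 => by
    obtain ⟨z, hz, hyz⟩ := exists_lt_of_lt_csSup ⟨x, hAself x⟩ h2
    exact hAmono hz le_rfl h1 hyz.le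
  have hadd : ∀ x, x + 1 ≤ T x := by
    intro x
    refine le_of_forall_lt_imp_le_of_dense fun y hy => ?_
    rcases le_total x y with h | h
    · exact hle ⟨h, hweak x y h (by linarith)⟩
    · exact h.trans (hle (hAself x))
  have hTmono : Monotone T := by
    intro x x' hx
    refine csSup_le ⟨x, hAself x⟩ fun y hy => ?_
    rcases le_total x' y with h | h
    · exact hle (hAmono hy hx h le_rfl)
    · exact h.trans (by linarith [hadd x'])
  have hTle : ∀ (g : G) x, T (g • x) ≤ g • T x := by
    intro g x
    refine csSup_le ⟨_, hAself _⟩ fun y hy => ?_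
    rw [subgroup_le_smul]
    have := hAsmul g⁻¹ hy
    rw [inv_smul_smul] at this
    exact hle this
  have hTg : ∀ (g : G) x, g • T x = T (g • x) := by
    intro g x
    refine le_antisymm ?_ (hTle g x)
    rw [subgroup_smul_le']
    simpa only [inv_smul_smul] using hTle g⁻¹ (g • x)
  have hstrict : StrictMono T := by
    refine strictMono_of_flats_invariant hmin hTmono (fun u v huv h => ?_)
      (a := 0) (b := T 0) (by linarith [hadd 0, hadd (T 0)] : T 0 < T (T 0)).ne
    rw [← hTg, ← hTg, huv]
  -- By equivariance the range contains the orbit of `T 0`; a monotone map with dense range is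
  -- continuous.
  have hdense : DenseRange T := by
    refine (MulAction.dense_orbit G (T 0)).mono ?_
    rintro _ ⟨g, rfl⟩
    exact ⟨g • 0, (hTg g 0).symm⟩
  have hcont : Continuous T := hTmono.continuous_of_denseRange hdense
  have hsurj : Function.Surjective T := by
    intro y
    obtain ⟨x, hx⟩ := hdense.exists_mem_open isOpen_Iio (Set.nonempty_Iio (a := y))
    exact mem_range_of_exists_le_of_exists_ge hcont ⟨x, le_of_lt hx⟩
      ⟨y, by linarith [hadd y]⟩
  exact ⟨homeoPlusOfStrictMono T hstrict hsurj, hadd, hTg, fun c d h1 h2 => (hmem h1 h2).2⟩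

/-- An interval of length less than `1` pulls back to one ending before `τ` of its left end, which
is contractible. Uniform continuity of `φ` on the compact target keeps the diameters tending to
zero. -/
theorem exists_conj_circleLifts {G : Subgroup HomeoPlus} (hmin : MulAction.IsMinimal G ℝ)
    (hw : WeakContraction G) (hns : ¬ StrongContraction G) :
    ∃ φ : HomeoPlus, conjugateGroup φ G ≤ CircleLifts ∧ WeakContraction (conjugateGroup φ G) := by
  obtain ⟨l₁, l₂, hl, hweak⟩ := hw
  obtain ⟨τ, hτ, hcomm, hcontr⟩ := exists_commuting_of_weakContraction hmin hl hweak hns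
  obtain ⟨φ, hφ⟩ := exists_conj_translation τ hτ
  have hφ' : ∀ x : ℝ, φ⁻¹ • (x + 1) = τ • φ⁻¹ • x := by
    intro x
    rw [inv_smul_eq_iff, hφ, smul_inv_smul]
  refine ⟨φ, ?_, φ • l₁, φ • l₂, (homeoPlus_strictMono φ).monotone hl, fun c d hcd hlt => ?_⟩
  · rintro _ ⟨g, hg, rfl⟩ x
    have h1 : g • τ • φ⁻¹ • x = τ • g • φ⁻¹ • x := hcomm ⟨g, hg⟩ _
    simp only [MulEquiv.toMonoidHom_eq_coe, MonoidHom.coe_coe, MulAut.conj_apply, mul_smul]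
    rw [hφ', h1, hφ]
  · have hcd' : φ⁻¹ • c ≤ φ⁻¹ • d := (homeoPlus_strictMono φ⁻¹).monotone hcd
    have hlt' : φ⁻¹ • d < τ • φ⁻¹ • c := by
      rw [← hφ']
      exact homeoPlus_strictMono φ⁻¹ (by linarith)
    obtain ⟨h, hh, hlim⟩ := (contractsInto_Icc_iff hcd').1 (hcontr _ _ hcd' hlt')
    refine (contractsInto_Icc_iff hcd).2
      ⟨fun n => ⟨φ * h n * φ⁻¹, h n, (h n).2, rfl⟩, fun n => ?_, ?_⟩
    · simp only [Subgroup.smul_def, mul_smul]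
      exact ⟨(homeoPlus_strictMono φ).monotone (hh n).1, (homeoPlus_strictMono φ).monotone (hh n).2⟩
    · simp only [Subgroup.smul_def, mul_smul] at hh hlim ⊢
      have hmem : ∀ n, (h n : HomeoPlus) • φ⁻¹ • c ∈ Set.Icc l₁ l₂ ∧
          (h n : HomeoPlus) • φ⁻¹ • d ∈ Set.Icc l₁ l₂ := fun n => by
        have : (h n : HomeoPlus) • φ⁻¹ • c ≤ (h n : HomeoPlus) • φ⁻¹ • d :=
          (homeoPlus_strictMono _).monotone hcd'
        exact ⟨⟨(hh n).1, this.trans (hh n).2⟩, ⟨(hh n).1.trans this, (hh n).2⟩⟩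
      have hu := Metric.uniformContinuousOn_iff.1
        ((isCompact_Icc (a := l₁) (b := l₂)).uniformContinuousOn_of_continuous
          (homeoPlus_continuous φ).continuousOn)
      refine Metric.tendsto_atTop.2 fun ε hε => ?_
      obtain ⟨δ, hδ, hδε⟩ := hu ε hε
      obtain ⟨N, hN⟩ := Metric.tendsto_atTop.1 hlim δ hδ
      refine ⟨N, fun n hn => ?_⟩
      have h1 := hN n hn
      rw [Real.dist_eq, sub_zero, ← Real.dist_eq] at h1
      have h2 := hδε _ (hmem n).2 _ (hmem n).1 h1
      rw [Real.dist_eq, sub_zero, ← Real.dist_eq]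
      exact h2

/-! ### Assembly of the two stability statements. -/

/-- The symmetric law described by a finitely supported symmetric probability mass function. -/
noncomputable def SymmetricLaw.ofPMF {Γ : Type*} [Group Γ] (μ : PMF Γ) (hfin : μ.support.Finite)
    (hsymm : ∀ g : Γ, μ g⁻¹ = μ g) (hgen : Subgroup.closure μ.support = ⊤) : SymmetricLaw Γ where
  supp := hfin.toFinset
  weight g := (μ g).toReal
  weight_pos g hg := ENNReal.toReal_pos (by simpa using hg) (μ.apply_ne_top g)
  sum_weight := by
    have h : ∑' g, μ g = ∑ g ∈ hfin.toFinset, μ g := tsum_eq_sum fun g hg => by simpa using hg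
    rw [← ENNReal.toReal_sum fun g _ => μ.apply_ne_top g, ← h, μ.tsum_coe, ENNReal.toReal_one]
  inv_mem g hg := by simpa [hsymm] using hg
  weight_inv g := by rw [hsymm]
  closure_supp := by rw [Set.Finite.coe_toFinset, hgen]

theorem SymmetricLaw.ofPMF_isLawOf {G : Subgroup HomeoPlus} (μ : PMF G) (hfin : μ.support.Finite)
    (hsymm : ∀ g : G, μ g⁻¹ = μ g) (hgen : Subgroup.closure μ.support = ⊤) :
    (SymmetricLaw.ofPMF μ hfin hsymm hgen).IsLawOf μ where
  support_eq := hfin.coe_toFinset.symm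
  apply_eq g := (ENNReal.ofReal_toReal (μ.apply_ne_top g)).symm

namespace SymmetricLaw

variable {G : Subgroup HomeoPlus} {m : SymmetricLaw G} {μ : PMF G}

/-- Since `F` is unbounded above, the barriers `M = n + 1` are all admissible, and the failure
probability is at most `(F y - F x) / (n + 1)` for every `n`. -/
theorem IsLawOf.ae_stableAlong (hμ : m.IsLawOf μ) (hmin : MulAction.IsMinimal G ℝ)
    (hirr : IsIrreducibleAction G) (hstrong : StrongContraction G) {x y : ℝ} (hxy : x < y) :
    ∀ᵐ ω ∂(incrementLaw μ), ∀ a b : ℝ, StableAlong (Set.Icc a b) (chain ω x) (chain ω y) := by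
  obtain ⟨F, hF, hcont, hharm, hunb⟩ := m.exists_martingale_coordinate hmin hirr
  obtain ⟨l₁, l₂, -, hL⟩ := hstrong
  have hbad : ∀ n : ℕ, incrementLaw μ {ω | ¬ ∀ a b, ∀ ε > 0, ∀ᶠ n in atTop,
      leftWalk ω n • x ∈ Set.Icc a b → F (leftWalk ω n • y) - F (leftWalk ω n • x) < ε} ≤
      ENNReal.ofReal ((F y - F x) / (n + 1)) := by
    intro n
    refine hμ.incrementLaw_not_stable_le hF hcont (c := 0) (fun x => by rw [hharm, add_zero])
      (by positivity) (fun b => ?_) (fun u v huv _ ε hε => ?_) hxy.le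
    · obtain ⟨_, ⟨B, rfl⟩, hB⟩ := not_bddAbove_iff.1 hunb (F b + (n + 1))
      refine ⟨B, fun u v hu hle => ?_⟩
      have := hF.monotone hu
      exact (hF.lt_iff_lt.1 (by linarith)).le
    · exact (hL u v huv).exists_sub_lt huv hcont hε
  have hzero : Tendsto (fun n : ℕ => ENNReal.ofReal ((F y - F x) / ((n : ℝ) + 1))) atTop (𝓝 0) := by
    have h1 : Tendsto (fun n : ℕ => (F y - F x) / ((n : ℝ) + 1)) atTop (𝓝 0) :=
      Tendsto.div_atTop tendsto_const_nhds
        (tendsto_atTop_add_const_right _ _ tendsto_natCast_atTop_atTop)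
    simpa using ENNReal.tendsto_ofReal h1
  have hnull := le_antisymm (ge_of_tendsto' hzero hbad) zero_le
  have hae : ∀ᵐ ω ∂(incrementLaw μ), ∀ a b, ∀ ε > 0, ∀ᶠ n in atTop,
      leftWalk ω n • x ∈ Set.Icc a b → F (leftWalk ω n • y) - F (leftWalk ω n • x) < ε := hnull
  filter_upwards [hae] with ω hω a b
  exact stableAlong_of_coordinate hF hcont (fun n => (subgroup_smul_le _).2 hxy.le) (hω a b)

/-- One period of `F` has length `1`. With `M` midway between `F y' - F x'` and `1`, pairs below the
barrier are less than one translation apart, so weak contraction applies to them, while the failure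
probability stays below `1`. -/
theorem IsLawOf.incrementLaw_stableAlong_conj_pos (hμ : m.IsLawOf μ)
    (hmin : MulAction.IsMinimal G ℝ) (φ : HomeoPlus) (hlift : conjugateGroup φ G ≤ CircleLifts)
    (hweak : WeakContraction (conjugateGroup φ G)) {x y : ℝ} (hxy : x < y) (hyx : y < x + 1) :
    0 < incrementLaw μ {ω | ∀ a b : ℝ, a ≤ b →
      StableAlong (Set.Icc a b) (conjugateChain φ ω x) (conjugateChain φ ω y)} := by
  have hcomm : ∀ (g : G) (x : ℝ), φ • (g • φ⁻¹ • (φ • x + 1)) = φ • (g • x) + 1 := by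
    intro g x
    have h1 := hlift ⟨g, g.2, rfl⟩ (φ • x)
    simp only [MulEquiv.toMonoidHom_eq_coe, MonoidHom.coe_coe, MulAut.conj_apply, mul_smul,
      inv_smul_smul] at h1
    exact h1
  obtain ⟨F, c, hF, hcont, hharm, hper⟩ :=
    m.exists_periodic_coordinate hmin (φ : ℝ ≃ₜ ℝ) (homeoPlus_strictMono φ) hcomm
  replace hper : ∀ x, F (φ⁻¹ • (φ • x + 1)) = F x + 1 := hper
  set T : ℝ → ℝ := fun x => φ⁻¹ • (φ • x + 1) with hT
  have hTmono : Monotone T := fun u v huv => (homeoPlus_strictMono φ⁻¹).monotone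
    (by linarith [(homeoPlus_strictMono φ).monotone huv])
  have hφT : ∀ u, φ • T u = φ • u + 1 := fun u => smul_inv_smul _ _
  obtain ⟨l₁, l₂, -, hL⟩ := hweak
  set x' := φ⁻¹ • x with hx'
  set y' := φ⁻¹ • y with hy'
  have hxy' : x' < y' := homeoPlus_strictMono φ⁻¹ hxy
  have hyT : y' < T x' := by
    rw [hT]
    simp only [hx', smul_inv_smul]
    exact homeoPlus_strictMono φ⁻¹ hyx
  have hd0 : 0 < F y' - F x' := sub_pos.2 (hF hxy')
  have hd1 : F y' - F x' < 1 := by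
    have := hF hyT
    rw [hper] at this
    linarith
  set M := (F y' - F x' + 1) / 2 with hM
  have hM0 : 0 < M := by linarith
  have hM1 : M < 1 := by linarith
  have hMd : F y' - F x' < M := by linarith
  have hltT : ∀ u v, F v - F u ≤ M → v < T u := fun u v h => by
    refine hF.lt_iff_lt.1 ?_
    rw [hper]
    linarith
  have hbad := hμ.incrementLaw_not_stable_le hF hcont hharm hM0
    (fun b => ⟨T b, fun u v hu hle => (hltT u v hle).le.trans (hTmono hu)⟩)
    (fun u v huv hle ε hε => by
      have hlt : φ • v < φ • u + 1 := by
        rw [← hφT]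
        exact homeoPlus_strictMono φ (hltT u v hle)
      have hle' : φ • u ≤ φ • v := (homeoPlus_strictMono φ).monotone huv
      obtain ⟨⟨_, g, hg, rfl⟩, hgε⟩ := (hL _ _ hle' (by linarith)).exists_sub_lt hle'
        (hcont.comp (homeoPlus_continuous φ⁻¹)) hε
      refine ⟨⟨g, hg⟩, ?_⟩
      change F (φ⁻¹ • (φ * g * φ⁻¹) • φ • v) - F (φ⁻¹ • (φ * g * φ⁻¹) • φ • u) < ε at hgε
      simp only [mul_smul, inv_smul_smul] at hgε
      exact hgε)
    hxy'.le
  set good : Set (ℕ → G) := {ω | ∀ a b, ∀ ε > 0, ∀ᶠ n in atTop,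
      leftWalk ω n • x' ∈ Set.Icc a b → F (leftWalk ω n • y') - F (leftWalk ω n • x') < ε}
    with hgood
  have hgoodpos : 0 < incrementLaw μ good := by
    rw [pos_iff_ne_zero]
    intro h0
    -- Only subadditivity is used, so measurability of `good` is not needed.
    have h1 : (1 : ENNReal) ≤ incrementLaw μ good + incrementLaw μ goodᶜ := by
      rw [← measure_univ (μ := incrementLaw μ), ← Set.union_compl_self good]
      exact measure_union_le _ _
    rw [h0, zero_add] at h1
    have h2 := h1.trans hbad
    rw [ENNReal.one_le_ofReal, one_le_div hM0] at h2
    linarith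
  refine hgoodpos.trans_le (measure_mono fun ω hω a b _ => ?_)
  refine stableAlong_of_coordinate (F := fun t => F (φ⁻¹ • t))
    (hF.comp (homeoPlus_strictMono φ⁻¹)) (hcont.comp (homeoPlus_continuous φ⁻¹))
    (fun n => (homeoPlus_strictMono _).monotone hxy.le) fun ε hε => ?_
  filter_upwards [hω (φ⁻¹ • a) (φ⁻¹ • b) ε hε] with n hn hmem
  have hconj : ∀ t, φ⁻¹ • conjugateChain φ ω t n = leftWalk ω n • φ⁻¹ • t := fun t => by
    rw [conjugateChain, mul_smul, mul_smul, inv_smul_smul]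
    rfl
  have h1 : φ⁻¹ • a ≤ φ⁻¹ • conjugateChain φ ω x n :=
    (homeoPlus_strictMono φ⁻¹).monotone hmem.1
  have h2 : φ⁻¹ • conjugateChain φ ω x n ≤ φ⁻¹ • b :=
    (homeoPlus_strictMono φ⁻¹).monotone hmem.2
  rw [hconj] at h1 h2
  change F (φ⁻¹ • conjugateChain φ ω y n) - F (φ⁻¹ • conjugateChain φ ω x n) < ε
  rw [hconj, hconj]
  exact hn ⟨h1, h2⟩

end SymmetricLaw

theorem mainTheorem4 (G : Subgroup HomeoPlus) (μ : PMF G)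
    (hfin : μ.support.Finite)
    (hsymm : ∀ g : G, μ g⁻¹ = μ g)
    (hgen : Subgroup.closure μ.support = ⊤)
    (hirr : IsIrreducibleAction G)
    (hmin : MulAction.IsMinimal G ℝ) :
    -- strong contraction: almost sure global stability at a finite distance
    (StrongContraction G →
      ∀ x y : ℝ, x < y → ∀ a b : ℝ, a ≤ b →
        ∀ᵐ ω ∂(incrementLaw μ), StableAlong (Set.Icc a b) (chain ω x) (chain ω y)) ∧
    -- only weak contraction: `G` can be conjugated into the lifts of circle homeomorphisms
    (WeakContraction G → ¬ StrongContraction G →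
      ∃ φ : HomeoPlus, conjugateGroup φ G ≤ CircleLifts ∧
        WeakContraction (conjugateGroup φ G)) ∧
    -- and after any such conjugation, stability holds with positive probability
    (∀ φ : HomeoPlus, conjugateGroup φ G ≤ CircleLifts →
      WeakContraction (conjugateGroup φ G) →
      ∀ x y : ℝ, x < y → y < x + 1 →
        0 < incrementLaw μ {ω | ∀ a b : ℝ, a ≤ b →
          StableAlong (Set.Icc a b) (conjugateChain φ ω x) (conjugateChain φ ω y)}) := by
  have hμ := SymmetricLaw.ofPMF_isLawOf μ hfin hsymm hgen
  refine ⟨fun hstrong x y hxy a b _ => ?_, exists_conj_circleLifts hmin,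
    fun φ hlift hweak x y hxy hyx =>
      hμ.incrementLaw_stableAlong_conj_pos hmin φ hlift hweak hxy hyx⟩
  filter_upwards [hμ.ae_stableAlong hmin hirr hstrong hxy] with ω hω using hω a b
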